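/- The dual of a point $(a,b)\in\mathbb{R}^2$ is the line $y=ax-b$. Consider a two-coloured line arrangement consisting of the duals of a finite set $\mathcal B$ of points (blue lines) and of a finite set $\mathcal R$ of points (red lines). It is *in general position* if no two lines are parallel and no three are concurrent. It is *$1$-avoiding* if $\mathcal R$ and $\mathcal B$ are separated by a vertical line with $\mathcal R$ on its left, and no line through two distinct points of $\mathcal B$ meets the convex hull of $\mathcal R$. (Thus every blue line has larger slope than every red line, and every red line meets the blue lines in the same order.) A *pseudoline* is a simple curve in the plane that goes to infinity in both directions (the image of a closed embedding of $\mathbb{R}$). Let $\mathcal A$ be an arrangement of $k$ blue and $k$ red lines. A pseudoline is *semialternating* for $\mathcal A$ if it meets every line of $\mathcal A$ exactly once, crossing it there, the crossing points being distinct, and if, when $l_1,\dots,l_{2k}$ is the order in which it crosses the lines, $l_i$ and $l_{i+1}$ have different colours for every odd $i<2k$. An arrangement $\mathcal L$ *contains a semialternating path of size $s$* if some subarrangement $\mathcal A\subseteq\mathcal L$ of $s$ lines, half of them blue and half of them red, admits a semialternating pseudoline. **Lemma.** For every positive integer $n$ divisible by $11$ there is a $1$-avoiding line arrangement in general position, consisting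 of $n$ blue lines and $n$ red lines, whose largest semialternating path has size exactly $\frac{10}{11}\cdot 2n$. -/

import Mathlib

/-- The Euclidean plane, with its standard coordinates. -/
abbrev Plane : Type := ℝ × ℝ

/-- The dual line of the point `p = (a, b)`: the non-vertical line `y = a x - b`. -/
def dualLine (p : Plane) : Set Plane := {z | z.2 = p.1 * z.1 - p.2}

/-- The open half-plane above the dual line of `p`. -/
def aboveDual (p : Plane) : Set Plane := {z | p.1 * z.1 - p.2 < z.2}

/-- The open half-plane below the dual line of `p`. -/
def belowDual (p : Plane) : Set Plane := {z | z.2 < p.1 * z.1 - p.2}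

/-- General position: no three points collinear and no two points on a vertical line.
Dually: no three of the dual lines concurrent and no two of them parallel. -/
def GeneralPosition (P : Set Plane) : Prop :=
  (∀ p ∈ P, ∀ q ∈ P, ∀ r ∈ P, p ≠ q → q ≠ r → p ≠ r → ¬ Collinear ℝ {p, q, r}) ∧
  (∀ p ∈ P, ∀ q ∈ P, p ≠ q → p.1 ≠ q.1)

/-- `A` avoids `B`: no line through two points of `A` meets the convex hull of `B`. -/
def Avoids (A B : Set Plane) : Prop :=
  ∀ p ∈ A, ∀ q ∈ A, p ≠ q → Disjoint (line[ℝ, p, q] : Set Plane) (convexHull ℝ B)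

/-- The two-coloured arrangement with blue lines `dualLine p`, `p ∈ B`, and red lines `dualLine p`,
`p ∈ R`, is 1-avoiding: `R` and `B` are separated by a vertical line with `R` on the left, and
`B` avoids `R`. -/
def IsOneAvoiding (B R : Set Plane) : Prop :=
  (∃ c : ℝ, (∀ r ∈ R, r.1 < c) ∧ (∀ b ∈ B, c < b.1)) ∧ Avoids B R

/-- The curve `γ` meets the dual line of `p` exactly once, at time `t`, and crosses it there. -/
def CrossesOnceAt (γ : ℝ → Plane) (p : Plane) (t : ℝ) : Prop :=
  γ t ∈ dualLine p ∧
    (((∀ s < t, γ s ∈ aboveDual p) ∧ (∀ s > t, γ s ∈ belowDual p)) ∨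
     ((∀ s < t, γ s ∈ belowDual p) ∧ (∀ s > t, γ s ∈ aboveDual p)))

/-- `γ` parametrizes a pseudoline: a simple curve going to infinity in both directions. -/
def ParametrizesPseudoline (γ : ℝ → Plane) : Prop := Topology.IsClosedEmbedding γ

/-- The pseudoline parametrized by `γ` is semialternating for the two-coloured arrangement
dual to `B` (blue) and `R` (red), `|B| = |R| = k`: it crosses each line exactly once, in the
order `l 0, l 1, …, l (2k - 1)`, and for every `j < k` the lines `l (2j)` and `l (2j + 1)` have
different colours. -/
def IsSemialternating (γ : ℝ → Plane) (B R : Finset Plane) : Prop :=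
  ∃ (k : ℕ) (l : Fin (2 * k) → Plane) (t : Fin (2 * k) → ℝ),
    B.card = k ∧ R.card = k ∧
    Function.Injective l ∧ Set.range l = (B : Set Plane) ∪ (R : Set Plane) ∧
    StrictMono t ∧ (∀ i, CrossesOnceAt γ (l i) (t i)) ∧
    ∀ i j : Fin (2 * k), Even (i : ℕ) → (j : ℕ) = i + 1 →
      (l i ∈ B ∧ l j ∈ R) ∨ (l i ∈ R ∧ l j ∈ B)

/-- The arrangement dual to `B` (blue) and `R` (red) contains a semialternating path of size `s`:
some subarrangement of `s` lines, half of them blue and half red, admits a semialternating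
pseudoline. -/
def ContainsSemialternatingPath (B R : Finset Plane) (s : ℕ) : Prop :=
  ∃ B' ⊆ B, ∃ R' ⊆ R, B'.card + R'.card = s ∧
    ∃ γ : ℝ → Plane, ParametrizesPseudoline γ ∧ IsSemialternating γ B' R'

/-! Write n = 11m. The red points form two columns, B near x = -2 (5m points) and A near x = -1 (6m
points); the blue points form R near (0, -10) (m + 2 points) and L near x = 1 (10m - 2 points).

Lower bound. The dual of the origin is the horizontal axis, which crosses the dual line of p at the
slope of p seen from the origin. The slopes of the red points and of L interleave, so all of L can
be paired with red lines. Two lines of R, one crossed before and one after everything else, raise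
the total to 10m of each colour (`containsSemialternatingPath_points`).

Upper bound. A longer path has k > 10m lines of each colour. It then uses at least three lines of R
and, in each red column, at least two lines more than it uses of R. Record after each step which
lines lie above the curve. Each line changes sides once, at its own step, and semialternation keeps
the numbers of unswept red and blue lines within one of each other
(`IsSemialternating.exists_balancedSweep`). The order type of the four columns forbids some sign
patterns: R lies below all segments from red points to L, and the points of L and of R see A on
opposite sides of B.

These rules contradict balance (`BalancedSweep.card_bound`). Up to reversal of the sweep, either all
red lines start above, or red lines start on both sides and all blue lines start above. In most
cases R is still complete when at most one red line is left; otherwise a block of lines of one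
colour is swept while too few of the other are. -/

/-- The number of elements of `S` with index at least `i`. -/
def remaining {ι : Type*} (S : Finset ι) (idx : ι → ℕ) (i : ℕ) : ℕ := (S.filter (i ≤ idx ·)).card

/-- The sign sequences of a balanced sweep of the four bundles `A`, `B` (red) and `L`, `R` (blue).
The line `p` is swept in step `idx p`, and `up p i` says that it is above the sweeping curve
after `i` steps. -/
structure BalancedSweep {ι : Type*} [DecidableEq ι] (A B L R : Finset ι) (k : ℕ)
    (idx : ι → ℕ) (up : ι → ℕ → Prop) : Prop where
  card_red : (A ∪ B).card = k
  card_blue : (L ∪ R).card = k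
  disjoint_red : Disjoint A B
  disjoint_blue : Disjoint L R
  disjoint : Disjoint (A ∪ B) (L ∪ R)
  idx_lt : ∀ p ∈ (A ∪ B) ∪ (L ∪ R), idx p < 2 * k
  idx_inj : Set.InjOn idx ((A ∪ B) ∪ (L ∪ R) : Finset ι)
  flip : ∀ p ∈ (A ∪ B) ∪ (L ∪ R), ∀ i, up p i ↔ (up p 0 ↔ i ≤ idx p)
  red_le : ∀ i, remaining (A ∪ B) idx i ≤ remaining (L ∪ R) idx i + 1
  blue_le : ∀ i, remaining (L ∪ R) idx i ≤ remaining (A ∪ B) idx i + 1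
  -- The remaining fields are the traces of the order type: sign patterns of three lines that never
  -- occur. In `order_A` and `order_B` the alternative depends on the pair only, so it can be
  -- applied to different blue lines at different moments.
  not_up_up_down : ∀ ρ ∈ A ∪ B, ∀ x ∈ L, ∀ y ∈ R, ∀ i, up ρ i → up x i → up y i
  left_order : ∀ x ∈ L, ∀ α ∈ A, ∀ β ∈ B, ∀ i, up x i → up β i → up α i
  right_order : ∀ y ∈ R, ∀ α ∈ A, ∀ β ∈ B, ∀ i, ¬ up y i → up α i → up β i
  order_A : ∀ p ∈ A, ∀ q ∈ A, p ≠ q → (∀ x ∈ L ∪ R, ∀ i, up x i → up p i → up q i) ∨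
    (∀ x ∈ L ∪ R, ∀ i, up x i → up q i → up p i)
  order_B : ∀ p ∈ B, ∀ q ∈ B, p ≠ q → (∀ x ∈ L ∪ R, ∀ i, up x i → up p i → up q i) ∨
    (∀ x ∈ L ∪ R, ∀ i, up x i → up q i → up p i)

/-! ### Counting unswept lines -/

section counting

variable {ι : Type*} (idx : ι → ℕ)

lemma remaining_le_card (S : Finset ι) (i : ℕ) : remaining S idx i ≤ S.card :=
  Finset.card_filter_le _ _

lemma remaining_union [DecidableEq ι] {S T : Finset ι} (h : Disjoint S T) (i : ℕ) :
    remaining (S ∪ T) idx i = remaining S idx i + remaining T idx i := by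
  unfold remaining
  rw [Finset.filter_union, Finset.card_union_of_disjoint (Finset.disjoint_filter_filter h)]

lemma remaining_mono {S T : Finset ι} (h : S ⊆ T) (i : ℕ) : remaining S idx i ≤ remaining T idx i :=
  Finset.card_le_card (Finset.filter_subset_filter _ h)

lemma remaining_eq_card {S : Finset ι} {i : ℕ} (h : ∀ p ∈ S, i ≤ idx p) :
    remaining S idx i = S.card := by
  unfold remaining; rw [Finset.filter_true_of_mem h]

lemma remaining_eq_zero {S : Finset ι} {i : ℕ} (h : ∀ p ∈ S, idx p < i) :
    remaining S idx i = 0 := by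
  unfold remaining
  rw [Finset.card_eq_zero, Finset.filter_eq_empty_iff]
  intro p hp; have := h p hp; omega

lemma remaining_succ {S : Finset ι} {i : ℕ} (h : ∀ p ∈ S, idx p ≠ i) :
    remaining S idx (i + 1) = remaining S idx i := by
  unfold remaining
  congr 1
  apply Finset.filter_congr
  intro p hp; have := h p hp; omega

lemma remaining_idx_succ [DecidableEq ι] {S : Finset ι} (hi : Set.InjOn idx S) {x : ι} (hx : x ∈ S) :
    remaining S idx (idx x + 1) + 1 = remaining S idx (idx x) := by
  unfold remaining
  rw [← Finset.card_insert_of_notMem (a := x) (by simp)]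
  congr 1
  ext p
  simp only [Finset.mem_insert, Finset.mem_filter]
  constructor
  · rintro (rfl | ⟨h1, h2⟩)
    · exact ⟨hx, le_rfl⟩
    · exact ⟨h1, by omega⟩
  · rintro ⟨h1, h2⟩
    by_cases h : p = x
    · exact Or.inl h
    · refine Or.inr ⟨h1, ?_⟩
      have : idx p ≠ idx x := fun e => h (hi h1 hx e)
      omega

lemma exists_lt_of_remaining_lt {S : Finset ι} {i : ℕ} (h : remaining S idx i < S.card) :
    ∃ p ∈ S, idx p < i := by
  by_contra! hc
  rw [remaining_eq_card idx hc] at h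
  omega

lemma exists_ge_of_remaining_pos {S : Finset ι} {i : ℕ} (h : 0 < remaining S idx i) :
    ∃ p ∈ S, i ≤ idx p := by
  by_contra! hc
  rw [remaining_eq_zero idx hc] at h
  omega

lemma exists_min_idx {S : Finset ι} (h : S.Nonempty) : ∃ x ∈ S, ∀ p ∈ S, idx x ≤ idx p :=
  S.exists_min_image idx h

lemma exists_max_idx {S : Finset ι} (h : S.Nonempty) : ∃ x ∈ S, ∀ p ∈ S, idx p ≤ idx x :=
  S.exists_max_image idx h

end counting

/-! ### The combinatorial obstruction to balanced sweeps -/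

namespace BalancedSweep

variable {ι : Type*} [DecidableEq ι] {A B L R : Finset ι} {k : ℕ} {idx : ι → ℕ}
  {up : ι → ℕ → Prop}

lemma memA {p : ι} (h : p ∈ A) : p ∈ (A ∪ B) ∪ (L ∪ R) := by simp [h]
lemma memB {p : ι} (h : p ∈ B) : p ∈ (A ∪ B) ∪ (L ∪ R) := by simp [h]
lemma memL {p : ι} (h : p ∈ L) : p ∈ (A ∪ B) ∪ (L ∪ R) := by simp [h]
lemma memR {p : ι} (h : p ∈ R) : p ∈ (A ∪ B) ∪ (L ∪ R) := by simp [h]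

lemma up_before (S : BalancedSweep A B L R k idx up) {p : ι} (hp : p ∈ (A ∪ B) ∪ (L ∪ R)) {i : ℕ}
    (h : i ≤ idx p) : up p i ↔ up p 0 := by
  rw [S.flip p hp i]; exact ⟨fun e => e.2 h, fun e => ⟨fun _ => h, fun _ => e⟩⟩

lemma up_after (S : BalancedSweep A B L R k idx up) {p : ι} (hp : p ∈ (A ∪ B) ∪ (L ∪ R)) {i : ℕ}
    (h : idx p < i) : up p i ↔ ¬ up p 0 := by
  rw [S.flip p hp i]; simp [not_le.2 h]

lemma idx_ne (S : BalancedSweep A B L R k idx up) {p q : ι} (hp : p ∈ A ∪ B) (hq : q ∈ L ∪ R) :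
    idx p ≠ idx q := fun e => by
  have := S.idx_inj (Finset.mem_coe.2 (Finset.mem_union_left _ hp))
    (Finset.mem_coe.2 (Finset.mem_union_right _ hq)) e
  subst this
  exact Finset.disjoint_left.1 S.disjoint hp hq

/-- The step at `idx x` costs a blue line and no red one, so the slack of one allowed after the step
is not available before it. -/
lemma red_le_of_blue (S : BalancedSweep A B L R k idx up) {x : ι} (hx : x ∈ L ∪ R) :
    remaining (A ∪ B) idx (idx x) ≤ remaining (L ∪ R) idx (idx x) := by
  have h1 := remaining_idx_succ idx (S.idx_inj.mono (fun _ h => Finset.mem_coe.2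
    (Finset.mem_union_right _ h))) hx
  have h2 := remaining_succ idx (S := A ∪ B) (i := idx x) fun p hp => S.idx_ne hp hx
  have := S.red_le (idx x + 1)
  omega

lemma blue_le_of_red (S : BalancedSweep A B L R k idx up) {x : ι} (hx : x ∈ A ∪ B) :
    remaining (L ∪ R) idx (idx x) ≤ remaining (A ∪ B) idx (idx x) := by
  have h1 := remaining_idx_succ idx (S.idx_inj.mono (fun _ h => Finset.mem_coe.2
    (Finset.mem_union_left _ h))) hx
  have h2 := remaining_succ idx (S := L ∪ R) (i := idx x) fun p hp => (S.idx_ne hx hp).symm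
  have := S.blue_le (idx x + 1)
  omega

/-- The last bundle `R` cannot be reached after all red lines but one have been swept. -/
lemma false_of_red_remaining_le_one (S : BalancedSweep A B L R k idx up) (hr : 3 ≤ R.card)
    {y : ι} (hmin : ∀ p ∈ R, idx y ≤ idx p)
    (h : remaining (A ∪ B) idx (idx y) ≤ 1) : False := by
  have h1 := S.blue_le (idx y)
  have h2 := remaining_union idx S.disjoint_blue (idx y)
  have h3 := remaining_eq_card idx hmin
  omega

/-- Red lines that are swept after all blue lines: there is at most one. -/
lemma card_le_one_of_after_blue (S : BalancedSweep A B L R k idx up) {D : Finset ι}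
    (hD : D ⊆ A ∪ B) (hL : (L ∪ R).Nonempty) (h : ∀ p ∈ D, ∀ x ∈ L ∪ R, idx x < idx p) :
    D.card ≤ 1 := by
  obtain ⟨x, hx, hmax⟩ := exists_max_idx idx hL
  have h1 : remaining (L ∪ R) idx (idx x + 1) = 0 :=
    remaining_eq_zero idx fun p hp => Nat.lt_succ_of_le (hmax p hp)
  have h2 := S.red_le (idx x + 1)
  have h3 := remaining_mono idx hD (idx x + 1)
  rw [remaining_eq_card idx fun p hp => h p hp x hx] at h3
  omega

/-- No balanced sweep starts with all blue lines above and with red lines on both sides. -/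
lemma false_of_mixed (S : BalancedSweep A B L R k idx up) (hr : 3 ≤ R.card)
    (ha : R.card + 2 ≤ A.card) (hb : R.card + 2 ≤ B.card)
    (hblue : ∀ x ∈ L ∪ R, up x 0) (hU : ∃ p ∈ A ∪ B, up p 0) (hD : ∃ p ∈ A ∪ B, ¬ up p 0) :
    False := by
  have hcA := Finset.card_union_of_disjoint S.disjoint_red
  have hcB := Finset.card_union_of_disjoint S.disjoint_blue
  have e1 := S.card_red
  have e2 := S.card_blue
  have hLn : L.Nonempty := Finset.card_pos.1 (by omega)
  have hRn : R.Nonempty := Finset.card_pos.1 (by omega)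
  obtain ⟨x, hx, hxm⟩ := exists_max_idx idx hLn
  obtain ⟨y, hy, hym⟩ := exists_min_idx idx hRn
  have hx' : x ∈ L ∪ R := Finset.mem_union_left _ hx
  have hy' : y ∈ L ∪ R := Finset.mem_union_right _ hy
  have hLR : (L ∪ R).Nonempty := ⟨x, hx'⟩
  have hremL : remaining L idx (idx x) ≤ 1 := by
    have := remaining_idx_succ idx (S.idx_inj.mono (fun _ h => Finset.mem_coe.2
      (memL h))) hx
    have := remaining_eq_zero idx (S := L) (i := idx x + 1) fun p hp =>
      Nat.lt_succ_of_le (hxm p hp)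
    omega
  -- When the last line `x` of L is about to be swept, the unswept blue lines are `x` and lines of
  -- R. Balance bounds the unswept red lines likewise, and each red column is too large to be among
  -- them entirely.
  have hrem : remaining (A ∪ B) idx (idx x) ≤ R.card + 1 := by
    have h1 := S.red_le_of_blue hx'
    have h2 := remaining_union idx S.disjoint_blue (idx x)
    have h3 := remaining_le_card idx R (idx x)
    omega
  rw [remaining_union idx S.disjoint_red] at hrem
  obtain ⟨α₀, hα₀, hα₀x⟩ := exists_lt_of_remaining_lt idx (S := A) (i := idx x) (by omega)
  obtain ⟨β₀, hβ₀, hβ₀x⟩ := exists_lt_of_remaining_lt idx (S := B) (i := idx x) (by omega)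
  have hxup : up x (idx x) := (S.up_before (memL hx) le_rfl).2 (hblue x hx')
  have hydown : ¬ up y (idx y + 1) := by
    rw [S.up_after (memR hy) (Nat.lt_succ_self _)]; simpa using hblue y hy'
  have hsucc : remaining (A ∪ B) idx (idx y + 1) = remaining (A ∪ B) idx (idx y) :=
    remaining_succ idx fun p hp => S.idx_ne hp hy'
  apply S.false_of_red_remaining_le_one hr hym
  rw [← hsucc]
  by_cases hA : ∀ α ∈ A, up α 0
  · have hα₀d : ¬ up α₀ (idx x) := by
      rw [S.up_after (memA hα₀) hα₀x]; simpa using hA α₀ hα₀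
    have hBd : ∀ β ∈ B, ¬ up β (idx x) := fun β hβ h => hα₀d (S.left_order x hx α₀ hα₀ β hβ _ hxup h)
    have hβ₀u : up β₀ 0 := by
      have := hBd β₀ hβ₀
      rwa [S.up_after (memB hβ₀) hβ₀x, not_not] at this
    have hup : ∀ β ∈ B, up β 0 → idx β < idx x := by
      intro β hβ h
      by_contra hc
      exact hBd β hβ ((S.up_before (memB hβ) (not_lt.1 hc)).2 h)
    have hdown : ∀ β ∈ B, ¬ up β 0 → idx x ≤ idx β := by
      intro β hβ h
      by_contra hc
      exact hBd β hβ ((S.up_after (memB hβ) (not_le.1 hc)).2 h)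
    -- `β₀` goes from above to below before `x`, and `β` from below to above not before `x`. If a
    -- blue `z` were still above after the step of `β`, both sign patterns (`β₀` up, `β` down) and
    -- (`β` up, `β₀` down) would occur with `z` up, and `order_B` excludes one of them.
    have hlast : ∀ β ∈ B, ¬ up β 0 → ∀ z ∈ L ∪ R, idx z < idx β := by
      intro β hβ h z hz
      by_contra hc
      have hne := S.idx_ne (p := β) (Finset.mem_union_right _ hβ) hz
      have hzu : up z (idx β + 1) :=
        (S.up_before (Finset.mem_union_right _ hz) (by omega)).2 (hblue z hz)
      have hβu : up β (idx β + 1) := (S.up_after (memB hβ) (Nat.lt_succ_self _)).2 h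
      have hβ₀d : ¬ up β₀ (idx β + 1) := by
        rw [S.up_after (memB hβ₀) (by have := hdown β hβ h; omega)]; simpa using hβ₀u
      rcases S.order_B β₀ hβ₀ β hβ (by rintro rfl; exact h hβ₀u) with h4 | h4
      · exact h (h4 z hz 0 (hblue z hz) hβ₀u)
      · exact hβ₀d (h4 z hz _ hzu hβu)
    classical
    have hcard := S.card_le_one_of_after_blue (D := B.filter (¬ up · 0))
      ((Finset.filter_subset _ _).trans Finset.subset_union_right) hLR
      (fun p hp => hlast p (Finset.mem_filter.1 hp).1 (Finset.mem_filter.1 hp).2)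
    refine (Finset.card_le_card ?_).trans hcard
    intro p hp
    obtain ⟨hp, hpi⟩ := Finset.mem_filter.1 hp
    -- After `y` only initially low lines of B can remain. A line of A would force `β₁` above by
    -- `right_order`, and an initially high line of B would coexist with `x` above and `y` below.
    obtain ⟨β₁, hβ₁, hβ₁d⟩ : ∃ β ∈ B, ¬ up β 0 := by
      obtain ⟨q, hq, hqd⟩ := hD
      rcases Finset.mem_union.1 hq with h | h
      · exact absurd (hA q h) hqd
      · exact ⟨q, h, hqd⟩
    rcases Finset.mem_union.1 hp with h | h
    · exfalso
      have h1 : up p (idx y + 1) := (S.up_before (memA h) hpi).2 (hA p h)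
      have h2 := S.right_order y hy p h β₁ hβ₁ _ hydown h1
      exact hβ₁d ((S.up_before (memB hβ₁) (hlast β₁ hβ₁ hβ₁d y hy')).1 h2)
    · refine Finset.mem_filter.2 ⟨h, fun hu => ?_⟩
      have h1 : up p (idx y + 1) := (S.up_before (memB h) hpi).2 hu
      have h2 : up x (idx y + 1) :=
        (S.up_before (memL hx) (by have := hup p h hu; omega)).2 (hblue x hx')
      exact hydown (S.not_up_up_down p hp x hx y hy _ h1 h2)
  -- The same argument with the columns exchanged and the red signs inverted: now A carries both
  -- signs and its initially high lines come last.
  · push Not at hA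
    obtain ⟨α₂, hα₂, hα₂d⟩ := hA
    have hB : ∀ β ∈ B, ¬ up β 0 := fun β hβ h =>
      hα₂d (S.left_order x hx α₂ hα₂ β hβ 0 (hblue x hx') h)
    have hβ₀u : up β₀ (idx x) := (S.up_after (memB hβ₀) hβ₀x).2 (hB β₀ hβ₀)
    have hAu : ∀ α ∈ A, up α (idx x) := fun α hα => S.left_order x hx α hα β₀ hβ₀ _ hxup hβ₀u
    have hα₀d : ¬ up α₀ 0 := (S.up_after (memA hα₀) hα₀x).1 (hAu α₀ hα₀)
    have hup : ∀ α ∈ A, up α 0 → idx x ≤ idx α := by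
      intro α hα h
      by_contra hc
      exact (S.up_after (memA hα) (not_le.1 hc)).1 (hAu α hα) h
    have hdown : ∀ α ∈ A, ¬ up α 0 → idx α < idx x := by
      intro α hα h
      by_contra hc
      exact h ((S.up_before (memA hα) (not_lt.1 hc)).1 (hAu α hα))
    have hlast : ∀ α ∈ A, up α 0 → ∀ z ∈ L ∪ R, idx z < idx α := by
      intro α hα h z hz
      by_contra hc
      have hne := S.idx_ne (p := α) (Finset.mem_union_left _ hα) hz
      have hzu : up z (idx α + 1) :=
        (S.up_before (Finset.mem_union_right _ hz) (by omega)).2 (hblue z hz)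
      have hαd : ¬ up α (idx α + 1) := by
        rw [S.up_after (memA hα) (Nat.lt_succ_self _)]; simpa using h
      have hα₀u : up α₀ (idx α + 1) :=
        (S.up_after (memA hα₀) (by have := hup α hα h; omega)).2 hα₀d
      rcases S.order_A α₀ hα₀ α hα (by rintro rfl; exact hα₀d h) with h4 | h4
      · exact hαd (h4 z hz _ hzu hα₀u)
      · exact hα₀d (h4 z hz 0 (hblue z hz) h)
    classical
    have hcard := S.card_le_one_of_after_blue (D := A.filter (up · 0))
      ((Finset.filter_subset _ _).trans Finset.subset_union_left) hLR
      (fun p hp => hlast p (Finset.mem_filter.1 hp).1 (Finset.mem_filter.1 hp).2)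
    refine (Finset.card_le_card ?_).trans hcard
    intro p hp
    obtain ⟨hp, hpi⟩ := Finset.mem_filter.1 hp
    obtain ⟨α₁, hα₁, hα₁u⟩ : ∃ α ∈ A, up α 0 := by
      obtain ⟨q, hq, hqu⟩ := hU
      rcases Finset.mem_union.1 hq with h | h
      · exact ⟨q, h, hqu⟩
      · exact absurd hqu (hB q h)
    have hα₁y : up α₁ (idx y + 1) :=
      (S.up_before (memA hα₁) (hlast α₁ hα₁ hα₁u y hy')).2 hα₁u
    rcases Finset.mem_union.1 hp with h | h
    · refine Finset.mem_filter.2 ⟨h, ?_⟩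
      by_contra hd
      have h2 : up x (idx y + 1) :=
        (S.up_before (memL hx) (by have := hdown p h hd; omega)).2 (hblue x hx')
      exact hydown (S.not_up_up_down α₁ (Finset.mem_union_left _ hα₁) x hx y hy _ hα₁y h2)
    · exfalso
      have h1 := S.right_order y hy α₁ hα₁ p h _ hydown hα₁y
      exact hB p h ((S.up_before (memB h) hpi).1 h1)

/-- Just before the last red line is swept one red line is left, and `blue_le_of_red` gives the same
bound for blue. -/
lemma exists_last_red (S : BalancedSweep A B L R k idx up) (h : (A ∪ B).Nonempty) :
    ∃ ρ ∈ A ∪ B, (∀ p ∈ A ∪ B, idx p ≤ idx ρ) ∧ remaining (L ∪ R) idx (idx ρ) ≤ 1 := by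
  obtain ⟨ρ, hρ, hm⟩ := exists_max_idx idx h
  refine ⟨ρ, hρ, hm, (S.blue_le_of_red hρ).trans ?_⟩
  have := remaining_idx_succ idx (S.idx_inj.mono (fun _ h => Finset.mem_coe.2
    (Finset.mem_union_left _ h))) hρ
  have := remaining_eq_zero idx (S := A ∪ B) (i := idx ρ + 1) fun p hp =>
    Nat.lt_succ_of_le (hm p hp)
  omega

/-- No balanced sweep starts with all red lines above and with a line of `L` above. -/
lemma false_of_red_up_left_up (S : BalancedSweep A B L R k idx up) (hr : 3 ≤ R.card)
    (ha : R.card + 2 ≤ A.card) (hb : R.card + 2 ≤ B.card)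
    (hred : ∀ p ∈ A ∪ B, up p 0) (hx₀ : ∃ x ∈ L, up x 0) : False := by
  classical
  have hcA := Finset.card_union_of_disjoint S.disjoint_red
  have hcB := Finset.card_union_of_disjoint S.disjoint_blue
  have e1 := S.card_red
  have e2 := S.card_blue
  have hRn : R.Nonempty := Finset.card_pos.1 (by omega)
  obtain ⟨ρ, hρ, hρm, hρ1⟩ := S.exists_last_red (Finset.card_pos.1 (by omega))
  have hRu : ∀ y ∈ R, up y 0 := by
    obtain ⟨x, hx, hxu⟩ := hx₀
    exact fun y hy => S.not_up_up_down ρ hρ x hx y hy 0 (hred ρ hρ) hxu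
  have hρu : up ρ (idx ρ) := (S.up_before (Finset.mem_union_left _ hρ) le_rfl).2 (hred ρ hρ)
  rw [remaining_union idx S.disjoint_blue] at hρ1
  -- With `ρ` still above and `y₀` already below, no line of L can be above. Hence a line of L that
  -- starts below is swept only after `ρ`, and at most one such line exists.
  obtain ⟨y₀, hy₀, hy₀ρ⟩ := exists_lt_of_remaining_lt idx (S := R) (i := idx ρ) (by omega)
  have hLd : ∀ x ∈ L, ¬ up x (idx ρ) := by
    intro x hx h
    have := S.not_up_up_down ρ hρ x hx y₀ hy₀ _ hρu h
    exact (S.up_after (memR hy₀) hy₀ρ).1 this (hRu y₀ hy₀)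
  have hLdown : ∀ x ∈ L, ¬ up x 0 → idx ρ ≤ idx x := by
    intro x hx h
    by_contra hc
    exact hLd x hx ((S.up_after (memL hx) (not_le.1 hc)).2 h)
  have hcount : (L.filter (¬ up · 0)).card ≤ 1 := by
    refine le_trans ?_ ((Nat.le_add_right _ _).trans hρ1)
    refine Finset.card_le_card fun x hx => ?_
    obtain ⟨h1, h2⟩ := Finset.mem_filter.1 hx
    exact Finset.mem_filter.2 ⟨h1, hLdown x h1 h2⟩
  obtain ⟨y, hy, hym⟩ := exists_min_idx idx hRn
  have hy' : y ∈ L ∪ R := Finset.mem_union_right _ hy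
  have hydown : ¬ up y (idx y + 1) := by
    rw [S.up_after (memR hy) (Nat.lt_succ_self _)]; simpa using hRu y hy
  apply S.false_of_red_remaining_le_one hr hym
  rw [← remaining_succ idx fun p hp => S.idx_ne hp hy']
  refine le_of_eq_of_le (remaining_eq_zero idx ?_) zero_le_one
  -- If a line of L is still above after `y` has gone below, no red line can still be above, so all
  -- are swept. Otherwise L is almost exhausted before `y`.
  by_cases hcase : ∃ x ∈ L, up x 0 ∧ idx y + 1 ≤ idx x
  · obtain ⟨x, hx, hxu, hxy⟩ := hcase
    intro p hp
    by_contra hc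
    exact hydown (S.not_up_up_down p hp x hx y hy _
      ((S.up_before (Finset.mem_union_left _ hp) (not_lt.1 hc)).2 (hred p hp))
      ((S.up_before (memL hx) hxy).2 hxu))
  push Not at hcase
  have hcase' : ∀ x ∈ L, up x 0 → idx x < idx y := by
    intro x hx hu
    have h1 := hcase x hx hu
    have h2 : idx x ≠ idx y := fun e => by
      have := S.idx_inj (Finset.mem_coe.2 (memL hx)) (Finset.mem_coe.2 (memR hy)) e
      subst this
      exact Finset.disjoint_left.1 S.disjoint_blue hx hy
    omega
  have hremL : remaining L idx (idx y) ≤ 1 := by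
    refine le_trans (Finset.card_le_card fun x hx => ?_) hcount
    obtain ⟨h1, h2⟩ := Finset.mem_filter.1 hx
    refine Finset.mem_filter.2 ⟨h1, fun hu => ?_⟩
    have := hcase' x h1 hu
    omega
  have hremA : remaining A idx (idx y) + remaining B idx (idx y) ≤ R.card + 1 := by
    have h1 := S.red_le_of_blue hy'
    have h2 := remaining_le_card idx R (idx y)
    rw [remaining_union idx S.disjoint_blue, remaining_union idx S.disjoint_red] at h1
    omega
  obtain ⟨β₀, hβ₀, hβ₀y⟩ := exists_lt_of_remaining_lt idx (S := B) (i := idx y) (by omega)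
  have hβ₀d : ¬ up β₀ (idx y + 1) := by
    rw [S.up_after (memB hβ₀) (by omega)]
    simpa using hred β₀ (Finset.mem_union_right _ hβ₀)
  have hAall : ∀ α ∈ A, idx α < idx y + 1 := by
    intro α hα
    by_contra hc
    exact hβ₀d (S.right_order y hy α hα β₀ hβ₀ _ hydown
      ((S.up_before (memA hα) (not_lt.1 hc)).2 (hred α (Finset.mem_union_left _ hα))))
  intro p hp
  rcases Finset.mem_union.1 hp with h | h
  · exact hAall p h
  by_contra hc
  have hpy : idx y + 1 ≤ idx p := not_lt.1 hc
  -- Suppose `p` in B survives `y`. Being above at the step of the last initially high line `x` of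
  -- L, it keeps all of A above by `left_order`. So A is swept entirely between `x` and `y`, while
  -- no blue line is swept there, and A has more than two lines.
  obtain ⟨x, hx, hxm⟩ := exists_max_idx idx (S := L.filter (up · 0))
    (by obtain ⟨x, hx, hxu⟩ := hx₀; exact ⟨x, Finset.mem_filter.2 ⟨hx, hxu⟩⟩)
  obtain ⟨hx, hxu⟩ := Finset.mem_filter.1 hx
  have hxy := hcase' x hx hxu
  have hAx : ∀ α ∈ A, idx x + 1 ≤ idx α := by
    intro α hα
    have hne := S.idx_ne (p := α) (Finset.mem_union_left _ hα) (Finset.mem_union_left R hx)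
    by_contra hc'
    have h1 : up p (idx x) := (S.up_before (memB h) (by omega)).2 (hred p hp)
    have h2 := S.left_order x hx α hα p h _ ((S.up_before (memL hx) le_rfl).2 hxu) h1
    exact (S.up_after (memA hα) (by omega)).1 h2 (hred α (Finset.mem_union_left _ hα))
  have h1 := S.red_le (idx x + 1)
  have h2 := S.blue_le (idx y)
  rw [remaining_union idx S.disjoint_red, remaining_union idx S.disjoint_blue] at h1 h2
  have h3 := remaining_eq_card idx hAx
  have h4 : remaining A idx (idx y) = 0 := remaining_eq_zero idx fun α hα => by
    have := hAall α hα
    have := S.idx_ne (p := α) (Finset.mem_union_left _ hα) hy'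
    omega
  have h5 : remaining R idx (idx y) = R.card := remaining_eq_card idx hym
  have h6 := remaining_le_card idx R (idx x + 1)
  have h7 : remaining L idx (idx x + 1) ≤ remaining L idx (idx y) := by
    refine Finset.card_le_card fun z hz => ?_
    obtain ⟨hz, hzi⟩ := Finset.mem_filter.1 hz
    refine Finset.mem_filter.2 ⟨hz, ?_⟩
    by_cases hzu : up z 0
    · have := hxm z (Finset.mem_filter.2 ⟨hz, hzu⟩)
      omega
    · have := hLdown z hz hzu
      have := hρm p hp
      omega
  have h8 : remaining B idx (idx y) ≤ remaining B idx (idx x + 1) := by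
    refine Finset.card_le_card fun z hz => ?_
    obtain ⟨hz, hzi⟩ := Finset.mem_filter.1 hz
    exact Finset.mem_filter.2 ⟨hz, by omega⟩
  omega

/-- No balanced sweep starts with all red lines above and all lines of `L` below. -/
lemma false_of_red_up_left_down (S : BalancedSweep A B L R k idx up) (hr : 3 ≤ R.card)
    (ha : R.card + 2 ≤ A.card) (hb : R.card + 2 ≤ B.card)
    (hred : ∀ p ∈ A ∪ B, up p 0) (hL : ∀ x ∈ L, ¬ up x 0) : False := by
  classical
  have hcA := Finset.card_union_of_disjoint S.disjoint_red
  have hcB := Finset.card_union_of_disjoint S.disjoint_blue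
  have e1 := S.card_red
  have e2 := S.card_blue
  obtain ⟨ρ, hρ, hρm, hρ1⟩ := S.exists_last_red (Finset.card_pos.1 (by omega))
  have hρu : up ρ (idx ρ) := (S.up_before (Finset.mem_union_left _ hρ) le_rfl).2 (hred ρ hρ)
  rw [remaining_union idx S.disjoint_blue] at hρ1
  obtain ⟨x₀, hx₀, hx₀ρ⟩ := exists_lt_of_remaining_lt idx (S := L) (i := idx ρ) (by omega)
  -- Once `x₀` is above together with `ρ`, all of R is above. An initially high line of R must then
  -- be unswept, and at most one blue line is; so at least two lines of R start below.
  have hRu : ∀ y ∈ R, up y (idx ρ) := fun y hy => S.not_up_up_down ρ hρ x₀ hx₀ y hy _ hρu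
    ((S.up_after (memL hx₀) hx₀ρ).2 (hL x₀ hx₀))
  have hcount : (R.filter (up · 0)).card ≤ 1 := by
    refine le_trans (Finset.card_le_card fun y hy => ?_) ((Nat.le_add_left _ _).trans hρ1)
    obtain ⟨h1, h2⟩ := Finset.mem_filter.1 hy
    refine Finset.mem_filter.2 ⟨h1, ?_⟩
    by_contra hc
    exact (S.up_after (memR h1) (not_le.1 hc)).1 (hRu y h1) h2
  have hcount2 : 2 ≤ (R.filter (¬ up · 0)).card := by
    have := Finset.card_filter_add_card_filter_not (s := R) (up · 0)
    omega
  obtain ⟨x, hx, hxm⟩ := exists_min_idx idx (S := L) (Finset.card_pos.1 (by omega))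
  have hx' : x ∈ L ∪ R := Finset.mem_union_left _ hx
  have hxu : up x (idx x + 1) := (S.up_after (memL hx) (Nat.lt_succ_self _)).2 (hL x hx)
  have hsucc : remaining (A ∪ B) idx (idx x + 1) = remaining (A ∪ B) idx (idx x) :=
    remaining_succ idx fun p hp => S.idx_ne hp hx'
  have hLx := remaining_eq_card idx hxm
  have hblue := remaining_union idx S.disjoint_blue (idx x)
  -- A line of R still below after `x` has gone above would mean that no red line is left, although
  -- L was complete just before.
  have hRx : ∀ y ∈ R, ¬ up y 0 → idx y < idx x := by
    intro y hy hyd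
    by_contra hc
    have hne : idx y ≠ idx x := fun e => by
      have := S.idx_inj (Finset.mem_coe.2 (memR hy)) (Finset.mem_coe.2 (memL hx)) e
      subst this
      exact Finset.disjoint_left.1 S.disjoint_blue hx hy
    have h0 : remaining (A ∪ B) idx (idx x + 1) = 0 := remaining_eq_zero idx fun p hp => by
      by_contra hc'
      have h1 := S.not_up_up_down p hp x hx y hy _
        ((S.up_before (Finset.mem_union_left _ hp) (not_lt.1 hc')).2 (hred p hp)) hxu
      exact hyd ((S.up_before (memR hy) (by omega)).1 h1)
    have := S.blue_le (idx x)
    omega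
  have hredx : k ≤ remaining (A ∪ B) idx (idx x) + R.card + 1 := by
    have := S.blue_le (idx x)
    omega
  have hredx' := remaining_union idx S.disjoint_red (idx x)
  have hA1 := remaining_le_card idx A (idx x)
  have hB1 := remaining_le_card idx B (idx x)
  obtain ⟨α₁, hα₁, hα₁x⟩ := exists_ge_of_remaining_pos idx (S := A) (i := idx x) (by omega)
  obtain ⟨β₁, hβ₁, hβ₁x⟩ := exists_ge_of_remaining_pos idx (S := B) (i := idx x) (by omega)
  have hβne := S.idx_ne (p := β₁) (Finset.mem_union_right _ hβ₁) hx'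
  have hAx : ∀ α ∈ A, idx x ≤ idx α := by
    intro α hα
    by_contra hc
    have h1 := S.left_order x hx α hα β₁ hβ₁ _ hxu
      ((S.up_before (memB hβ₁) (by omega)).2 (hred β₁ (Finset.mem_union_right _ hβ₁)))
    exact (S.up_after (memA hα) (by omega)).1 h1 (hred α (Finset.mem_union_left _ hα))
  -- Up to the step of `y`, at least two lines of R are swept. No red line is: `β₁` protects A
  -- through `left_order`, and `α₁` protects B through `right_order`. This violates balance right
  -- after `y`.
  obtain ⟨y, hy, hym⟩ := exists_max_idx idx (S := R.filter (¬ up · 0))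
    (Finset.card_pos.1 (by omega))
  obtain ⟨hyR, hyd⟩ := Finset.mem_filter.1 hy
  have hyx := hRx y hyR hyd
  have hBy : ∀ β ∈ B, idx y ≤ idx β := by
    intro β hβ
    by_contra hc
    have h1 := S.right_order y hyR α₁ hα₁ β hβ (idx y)
      (fun h => hyd ((S.up_before (memR hyR) le_rfl).1 h))
      ((S.up_before (memA hα₁) (by omega)).2 (hred α₁ (Finset.mem_union_left _ hα₁)))
    exact (S.up_after (memB hβ) (by omega)).1 h1 (hred β (Finset.mem_union_right _ hβ))
  have hAy : ∀ α ∈ A, idx y ≤ idx α := fun α hα => hyx.le.trans (hAx α hα)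
  have h1 := S.red_le (idx y + 1)
  rw [remaining_succ idx fun p hp => S.idx_ne hp (Finset.mem_union_right L hyR),
    remaining_union idx S.disjoint_red, remaining_eq_card idx hAy, remaining_eq_card idx hBy] at h1
  have h2 : remaining (L ∪ R) idx (idx y + 1) + 2 ≤ k := by
    rw [← S.card_blue]
    have h3 : (R.filter (¬ up · 0)) ⊆ (L ∪ R) :=
      (Finset.filter_subset _ _).trans Finset.subset_union_right
    have h4 : remaining (L ∪ R) idx (idx y + 1) ≤ ((L ∪ R) \ (R.filter (¬ up · 0))).card := by
      refine Finset.card_le_card fun z hz => ?_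
      obtain ⟨hz, hzi⟩ := Finset.mem_filter.1 hz
      refine Finset.mem_sdiff.2 ⟨hz, fun hz' => ?_⟩
      have := hym z hz'
      omega
    rw [Finset.card_sdiff_of_subset h3] at h4
    have := Finset.card_le_card h3
    omega
  omega

/-- The sweep run backwards. -/
lemma reverse (S : BalancedSweep A B L R k idx up) :
    BalancedSweep A B L R k (fun p => 2 * k - 1 - idx p) (fun p i => up p (2 * k - i)) := by
  -- The lines unswept in one direction are those already swept in the other. As both colours have
  -- `k` lines, `red_le` and `blue_le` exchange roles.
  have hrem : ∀ {T : Finset ι}, T ⊆ (A ∪ B) ∪ (L ∪ R) → T.card = k → ∀ i,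
      remaining T (fun p => 2 * k - 1 - idx p) i + remaining T idx (2 * k - i) = k := by
    intro T hT hk i
    unfold remaining
    conv_rhs => rw [← hk, ← Finset.card_filter_add_card_filter_not (s := T)
      (fun p => i ≤ 2 * k - 1 - idx p)]
    congr 2
    apply Finset.filter_congr
    intro p hp
    have := S.idx_lt p (hT hp)
    omega
  have hr := hrem Finset.subset_union_left S.card_red
  have hb := hrem Finset.subset_union_right S.card_blue
  refine ⟨S.card_red, S.card_blue, S.disjoint_red, S.disjoint_blue, S.disjoint, ?_, ?_, ?_, ?_, ?_,
    fun ρ hρ x hx y hy i => S.not_up_up_down ρ hρ x hx y hy _,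
    fun x hx α hα β hβ i => S.left_order x hx α hα β hβ _,
    fun y hy α hα β hβ i => S.right_order y hy α hα β hβ _, ?_, ?_⟩
  · intro p hp
    have := S.idx_lt p hp
    omega
  · intro p hp q hq h
    have h1 := S.idx_lt p hp
    have h2 := S.idx_lt q hq
    exact S.idx_inj hp hq (by simp only at h; omega)
  · intro p hp i
    have h1 := S.idx_lt p hp
    rw [S.flip p hp (2 * k - i), S.flip p hp (2 * k - 0)]
    by_cases h : 2 * k - i ≤ idx p
    · have h' : ¬ (i ≤ 2 * k - 1 - idx p) := by omega
      have h'' : ¬ (2 * k - 0 ≤ idx p) := by omega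
      simp only [h, h', h'', iff_true, iff_false, not_not]
    · have h' : i ≤ 2 * k - 1 - idx p := by omega
      have h'' : ¬ (2 * k - 0 ≤ idx p) := by omega
      simp only [h, h', h'', iff_true, iff_false]
  · intro i
    have := S.blue_le (2 * k - i)
    have := hr i
    have := hb i
    omega
  · intro i
    have := S.red_le (2 * k - i)
    have := hr i
    have := hb i
    omega
  · intro p hp q hq hpq
    exact (S.order_A p hp q hq hpq).imp (fun h x hx i => h x hx _) (fun h x hx i => h x hx _)
  · intro p hp q hq hpq
    exact (S.order_B p hp q hq hpq).imp (fun h x hx i => h x hx _) (fun h x hx i => h x hx _)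

lemma up_end (S : BalancedSweep A B L R k idx up) {p : ι} (hp : p ∈ (A ∪ B) ∪ (L ∪ R)) :
    up p (2 * k - 0) ↔ ¬ up p 0 :=
  S.up_after hp (by simpa using S.idx_lt p hp)

lemma false_of_red_up (S : BalancedSweep A B L R k idx up) (hr : 3 ≤ R.card)
    (ha : R.card + 2 ≤ A.card) (hb : R.card + 2 ≤ B.card)
    (hred : ∀ p ∈ A ∪ B, up p 0) : False := by
  by_cases hx : ∃ x ∈ L, up x 0
  · exact S.false_of_red_up_left_up hr ha hb hred hx
  · push Not at hx
    exact S.false_of_red_up_left_down hr ha hb hred hx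

/-- A balanced sweep meets fewer than three lines of `R`, or few lines of `A` or of `B`. -/
theorem card_bound (S : BalancedSweep A B L R k idx up) (hr : 3 ≤ R.card)
    (ha : R.card + 2 ≤ A.card) (hb : R.card + 2 ≤ B.card) : False := by
  have hcA := Finset.card_union_of_disjoint S.disjoint_red
  have hcB := Finset.card_union_of_disjoint S.disjoint_blue
  have e1 := S.card_red
  have e2 := S.card_blue
  by_cases hU : ∀ p ∈ A ∪ B, up p 0
  · exact S.false_of_red_up hr ha hb hU
  by_cases hD : ∀ p ∈ A ∪ B, ¬ up p 0
  · exact S.reverse.false_of_red_up hr ha hb fun p hp =>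
      (S.up_end (Finset.mem_union_left _ hp)).2 (hD p hp)
  push Not at hU hD
  obtain ⟨p, hp, hpd⟩ := hU
  obtain ⟨q, hq, hqu⟩ := hD
  obtain ⟨x₀, hx₀⟩ : L.Nonempty := Finset.card_pos.1 (by omega)
  obtain ⟨y₀, hy₀⟩ : R.Nonempty := Finset.card_pos.1 (by omega)
  -- With red lines on both sides, `not_up_up_down` applies at the start (with `q`) and at the end
  -- (with `p`, where all signs are inverted). Together they put all blue lines initially on one
  -- side.
  have h1 : ∀ x ∈ L, ∀ y ∈ R, up x 0 → up y 0 := fun x hx y hy =>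
    S.not_up_up_down q hq x hx y hy 0 hqu
  have h2 : ∀ x ∈ L, ∀ y ∈ R, ¬ up x 0 → ¬ up y 0 := fun x hx y hy h => by
    have := S.not_up_up_down p hp x hx y hy (2 * k - 0)
      ((S.up_end (Finset.mem_union_left _ hp)).2 hpd) ((S.up_end (memL hx)).2 h)
    exact (S.up_end (memR hy)).1 this
  by_cases hx : up x₀ 0
  · have hR : ∀ y ∈ R, up y 0 := fun y hy => h1 x₀ hx₀ y hy hx
    refine S.false_of_mixed hr ha hb (fun z hz => ?_) ⟨q, hq, hqu⟩ ⟨p, hp, hpd⟩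
    rcases Finset.mem_union.1 hz with h | h
    · by_contra hc
      exact h2 z h y₀ hy₀ hc (hR y₀ hy₀)
    · exact hR z h
  · have hR : ∀ y ∈ R, ¬ up y 0 := fun y hy => h2 x₀ hx₀ y hy hx
    refine S.reverse.false_of_mixed hr ha hb (fun z hz => ?_)
      ⟨p, hp, (S.up_end (Finset.mem_union_left _ hp)).2 hpd⟩
      ⟨q, hq, fun h => (S.up_end (Finset.mem_union_left _ hq)).1 h hqu⟩
    refine (S.up_end (Finset.mem_union_right _ hz)).2 ?_
    rcases Finset.mem_union.1 hz with h | h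
    · exact fun hc => hR y₀ hy₀ (h1 z h y₀ hy₀ hc)
    · exact hR z h

end BalancedSweep
-- From point configurations to balanced sweeps
/-- Twice the signed area of the triangle `p q r`. -/
def orient (p q r : Plane) : ℝ := (q.1 - p.1) * (r.2 - p.2) - (q.2 - p.2) * (r.1 - p.1)

/-- The point `q` lies below the chord `p r`. So its dual line lies above the convex combination,
with the same slope, of the duals of `p` and `r`, and that combination passes above `z`. -/
lemma below_of_orient_pos {p q r z : Plane} (h1 : p.1 < q.1) (h2 : q.1 < r.1)
    (h : 0 < orient p q r) (hp : z ∈ belowDual p) (hr : z ∈ belowDual r) : z ∈ belowDual q := by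
  simp only [belowDual, Set.mem_ofPred_eq, orient] at *
  nlinarith [mul_pos (sub_pos.2 h1) (sub_pos.2 hr), mul_pos (sub_pos.2 h2) (sub_pos.2 hp)]

lemma above_of_orient_neg {p q r z : Plane} (h1 : p.1 < q.1) (h2 : q.1 < r.1)
    (h : orient p q r < 0) (hp : z ∈ aboveDual p) (hr : z ∈ aboveDual r) : z ∈ aboveDual q := by
  simp only [aboveDual, Set.mem_ofPred_eq, orient] at *
  nlinarith [mul_pos (sub_pos.2 h1) (sub_pos.2 hr), mul_pos (sub_pos.2 h2) (sub_pos.2 hp)]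

lemma not_below_of_above {p z : Plane} (h : z ∈ aboveDual p) : z ∉ belowDual p := by
  simp only [aboveDual, belowDual, Set.mem_ofPred_eq] at *
  exact not_lt.2 h.le

/-- Four columns `B`, `A`, `R`, `L` of points, from left to right, in the order type that makes
long semialternating paths impossible. -/
structure ColumnConfig (A B L R : Finset Plane) : Prop where
  fst_BA : ∀ β ∈ B, ∀ α ∈ A, β.1 < α.1
  fst_AR : ∀ α ∈ A, ∀ y ∈ R, α.1 < y.1
  fst_BR : ∀ β ∈ B, ∀ y ∈ R, β.1 < y.1
  fst_AL : ∀ α ∈ A, ∀ x ∈ L, α.1 < x.1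
  fst_BL : ∀ β ∈ B, ∀ x ∈ L, β.1 < x.1
  fst_RL : ∀ y ∈ R, ∀ x ∈ L, y.1 < x.1
  fst_inj_A : ∀ p ∈ A, ∀ q ∈ A, p ≠ q → p.1 ≠ q.1
  fst_inj_B : ∀ p ∈ B, ∀ q ∈ B, p ≠ q → p.1 ≠ q.1
  orient_ARL : ∀ α ∈ A, ∀ y ∈ R, ∀ x ∈ L, 0 < orient α y x
  orient_BRL : ∀ β ∈ B, ∀ y ∈ R, ∀ x ∈ L, 0 < orient β y x
  orient_BAL : ∀ β ∈ B, ∀ α ∈ A, ∀ x ∈ L, 0 < orient β α x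
  orient_BAR : ∀ β ∈ B, ∀ α ∈ A, ∀ y ∈ R, orient β α y < 0
  orient_AA : ∀ p ∈ A, ∀ q ∈ A, p.1 < q.1 → ∀ x ∈ L ∪ R, 0 < orient p q x
  orient_BB : ∀ p ∈ B, ∀ q ∈ B, p.1 < q.1 → ∀ x ∈ L ∪ R, 0 < orient p q x

lemma ColumnConfig.mono {A B L R A' B' L' R' : Finset Plane} (h : ColumnConfig A B L R)
    (hA : A' ⊆ A) (hB : B' ⊆ B) (hL : L' ⊆ L) (hR : R' ⊆ R) : ColumnConfig A' B' L' R' where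
  fst_BA _ hb _ ha := h.fst_BA _ (hB hb) _ (hA ha)
  fst_AR _ ha _ hy := h.fst_AR _ (hA ha) _ (hR hy)
  fst_BR _ hb _ hy := h.fst_BR _ (hB hb) _ (hR hy)
  fst_AL _ ha _ hx := h.fst_AL _ (hA ha) _ (hL hx)
  fst_BL _ hb _ hx := h.fst_BL _ (hB hb) _ (hL hx)
  fst_RL _ hy _ hx := h.fst_RL _ (hR hy) _ (hL hx)
  fst_inj_A _ hp _ hq := h.fst_inj_A _ (hA hp) _ (hA hq)
  fst_inj_B _ hp _ hq := h.fst_inj_B _ (hB hp) _ (hB hq)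
  orient_ARL _ ha _ hy _ hx := h.orient_ARL _ (hA ha) _ (hR hy) _ (hL hx)
  orient_BRL _ hb _ hy _ hx := h.orient_BRL _ (hB hb) _ (hR hy) _ (hL hx)
  orient_BAL _ hb _ ha _ hx := h.orient_BAL _ (hB hb) _ (hA ha) _ (hL hx)
  orient_BAR _ hb _ ha _ hy := h.orient_BAR _ (hB hb) _ (hA ha) _ (hR hy)
  orient_AA _ hp _ hq hpq _ hx :=
    h.orient_AA _ (hA hp) _ (hA hq) hpq _ (Finset.union_subset_union hL hR hx)
  orient_BB _ hp _ hq hpq _ hx :=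
    h.orient_BB _ (hB hp) _ (hB hq) hpq _ (Finset.union_subset_union hL hR hx)

lemma ColumnConfig.disjoint_red {A B L R : Finset Plane} (h : ColumnConfig A B L R) :
    Disjoint A B :=
  Finset.disjoint_left.2 fun p hp hq => lt_irrefl _ (h.fst_BA p hq p hp)

lemma ColumnConfig.disjoint_blue {A B L R : Finset Plane} (h : ColumnConfig A B L R) :
    Disjoint L R :=
  Finset.disjoint_left.2 fun p hp hq => lt_irrefl _ (h.fst_RL p hq p hp)

lemma ColumnConfig.disjoint {A B L R : Finset Plane} (h : ColumnConfig A B L R) :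
    Disjoint (A ∪ B) (L ∪ R) := by
  refine Finset.disjoint_left.2 fun p hp hq => ?_
  rcases Finset.mem_union.1 hp with h1 | h1 <;> rcases Finset.mem_union.1 hq with h2 | h2
  · exact lt_irrefl _ (h.fst_AL p h1 p h2)
  · exact lt_irrefl _ (h.fst_AR p h1 p h2)
  · exact lt_irrefl _ (h.fst_BL p h1 p h2)
  · exact lt_irrefl _ (h.fst_BR p h1 p h2)

/-- After an even number of steps of a sequence whose pairs `l (2 j)`, `l (2 j + 1)` meet both `S`
and its complement, half of the steps are in `S`. -/
lemma remaining_two_mul {ι : Type*} [DecidableEq ι] {S : Finset ι} {idx : ι → ℕ} {k : ℕ}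
    {l : Fin (2 * k) → ι} (hidx : ∀ i, idx (l i) = i) (hS : ∀ p ∈ S, ∃ i, l i = p)
    (hcard : S.card = k)
    (hpair : ∀ i j : Fin (2 * k), Even (i : ℕ) → (j : ℕ) = i + 1 →
      (l i ∈ S ∧ l j ∉ S) ∨ (l i ∉ S ∧ l j ∈ S)) :
    (∀ h ≤ k, remaining S idx (2 * h) + h = k) ∧
      ∀ h < k, remaining S idx (2 * h + 1) + h = k ∨ remaining S idx (2 * h + 1) + h + 1 = k := by
  have hinj : Set.InjOn idx S := by
    intro p hp q hq e
    obtain ⟨i, rfl⟩ := hS p hp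
    obtain ⟨j, rfl⟩ := hS q hq
    rw [hidx, hidx] at e
    rw [Fin.ext e]
  have hmem : ∀ i : Fin (2 * k), l i ∈ S → remaining S idx (i + 1) + 1 = remaining S idx i := by
    intro i hi
    have := remaining_idx_succ idx hinj hi
    rwa [hidx] at this
  have hnot : ∀ i : Fin (2 * k), l i ∉ S → remaining S idx (i + 1) = remaining S idx i := by
    intro i hi
    refine remaining_succ idx fun p hp e => hi ?_
    obtain ⟨j, rfl⟩ := hS p hp
    rw [hidx] at e
    rwa [← Fin.ext e]
  have key : ∀ h ≤ k, remaining S idx (2 * h) + h = k := by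
    intro h
    induction h with
    | zero => intro _; simpa [remaining] using hcard
    | succ h ih =>
      intro hk
      have h0 := ih (by omega)
      have hi : 2 * h < 2 * k := by omega
      have hj : 2 * h + 1 < 2 * k := by omega
      have e : 2 * (h + 1) = 2 * h + 1 + 1 := by ring
      rw [e]
      rcases hpair ⟨2 * h, hi⟩ ⟨2 * h + 1, hj⟩ (even_two_mul h) rfl with ⟨a, b⟩ | ⟨a, b⟩
      · have h1 := hmem _ a
        have h2 := hnot _ b
        simp only at h1 h2
        omega
      · have h1 := hnot _ a
        have h2 := hmem _ b
        simp only at h1 h2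
        omega
  refine ⟨key, fun h hk => ?_⟩
  have h0 := key h hk.le
  have hi : 2 * h < 2 * k := by omega
  by_cases hm : l ⟨2 * h, hi⟩ ∈ S
  · have := hmem _ hm
    simp only at this
    omega
  · have := hnot _ hm
    simp only at this
    omega

/-- The curve is sampled between consecutive crossings. A line counts as `up` when the sample point
is below it, so each forbidden sign pattern is an orientation of three points read in the dual. -/
lemma IsSemialternating.exists_balancedSweep {γ : ℝ → Plane} {A B L R : Finset Plane}
    (hc : ColumnConfig A B L R) (h : IsSemialternating γ (L ∪ R) (A ∪ B)) :
    ∃ (k : ℕ) (idx : Plane → ℕ) (up : Plane → ℕ → Prop), BalancedSweep A B L R k idx up := by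
  obtain ⟨k, l, t, hB, hR, hinj, hrange, hmono, hcross, hpair⟩ := h
  have hmem : ∀ p ∈ (A ∪ B) ∪ (L ∪ R), ∃ i, l i = p := by
    intro p hp
    have : p ∈ Set.range l := by
      rw [hrange, ← Finset.coe_union, Finset.mem_coe, Finset.union_comm]
      exact hp
    exact this
  obtain ⟨idx, hidx⟩ : ∃ idx : Plane → ℕ, ∀ i, idx (l i) = i :=
    ⟨Function.extend l (fun i => (i : ℕ)) 0, fun i => hinj.extend_apply _ _ i⟩
  have hs : ∀ i : ℕ, ∃ s : ℝ, ∀ j : Fin (2 * k), ((j : ℕ) < i → t j < s) ∧ (i ≤ j → s < t j) := by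
    intro i
    obtain ⟨s, h1, h2⟩ := Order.exists_between_finsets
      (lo := (Finset.univ.filter fun j : Fin (2 * k) => (j : ℕ) < i).image t)
      (hi := (Finset.univ.filter fun j : Fin (2 * k) => i ≤ (j : ℕ)).image t) (by
        intro x hx y hy
        simp only [Finset.mem_image, Finset.mem_filter, Finset.mem_univ, true_and] at hx hy
        obtain ⟨a, ha, rfl⟩ := hx
        obtain ⟨b, hb, rfl⟩ := hy
        exact hmono (Fin.lt_def.2 (by omega)))
    exact ⟨s, fun j => ⟨fun hj => h1 _ (Finset.mem_image_of_mem _ (by simpa using hj)),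
      fun hj => h2 _ (Finset.mem_image_of_mem _ (by simpa using hj))⟩⟩
  choose s hs using hs
  have hoff : ∀ p ∈ (A ∪ B) ∪ (L ∪ R), ∀ i, γ (s i) ∉ belowDual p → γ (s i) ∈ aboveDual p := by
    intro p hp i hn
    obtain ⟨j, rfl⟩ := hmem p hp
    obtain ⟨-, ⟨h1, h2⟩ | ⟨h1, h2⟩⟩ := hcross j
    · rcases lt_or_ge (j : ℕ) i with hj | hj
      · exact absurd (h2 _ ((hs i j).1 hj)) hn
      · exact h1 _ ((hs i j).2 hj)
    · rcases lt_or_ge (j : ℕ) i with hj | hj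
      · exact h2 _ ((hs i j).1 hj)
      · exact absurd (h1 _ ((hs i j).2 hj)) hn
  have hdisj := hc.disjoint
  have hblue := remaining_two_mul hidx (fun p hp => hmem p (Finset.mem_union_right _ hp)) hB
    fun i j hi hj => (hpair i j hi hj).imp
      (fun h => ⟨h.1, fun h' => Finset.disjoint_left.1 hdisj h.2 h'⟩)
      (fun h => ⟨fun h' => Finset.disjoint_left.1 hdisj h.1 h', h.2⟩)
  have hred := remaining_two_mul hidx (fun p hp => hmem p (Finset.mem_union_left _ hp)) hR
    fun i j hi hj => (hpair i j hi hj).symm.imp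
      (fun h => ⟨h.1, fun h' => Finset.disjoint_left.1 hdisj h' h.2⟩)
      (fun h => ⟨fun h' => Finset.disjoint_left.1 hdisj h' h.1, h.2⟩)
  have hidx_lt : ∀ p ∈ (A ∪ B) ∪ (L ∪ R), idx p < 2 * k := by
    intro p hp
    obtain ⟨j, rfl⟩ := hmem p hp
    rw [hidx]
    exact j.2
  have hbal : ∀ i, remaining (A ∪ B) idx i ≤ remaining (L ∪ R) idx i + 1 ∧
      remaining (L ∪ R) idx i ≤ remaining (A ∪ B) idx i + 1 := by
    intro i
    rcases lt_or_ge i (2 * k) with hi | hi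
    · rcases Nat.even_or_odd' i with ⟨h, rfl | rfl⟩
      · have := hblue.1 h (by omega)
        have := hred.1 h (by omega)
        omega
      · have := hblue.2 h (by omega)
        have := hred.2 h (by omega)
        omega
    · rw [remaining_eq_zero idx fun p hp =>
          (hidx_lt p (Finset.mem_union_left _ hp)).trans_le hi,
        remaining_eq_zero idx fun p hp => (hidx_lt p (Finset.mem_union_right _ hp)).trans_le hi]
      omega
  refine ⟨k, idx, fun p i => γ (s i) ∈ belowDual p, hR, hB, hc.disjoint_red, hc.disjoint_blue,
    hdisj, hidx_lt, ?_, ?_, fun i => (hbal i).1, fun i => (hbal i).2, ?_, ?_, ?_, ?_, ?_⟩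
  · intro p hp q hq e
    obtain ⟨i, rfl⟩ := hmem p hp
    obtain ⟨j, rfl⟩ := hmem q hq
    rw [hidx, hidx] at e
    rw [Fin.ext e]
  · intro p hp i
    obtain ⟨j, rfl⟩ := hmem p hp
    rw [hidx]
    have h0 := (hs 0 j).2 (Nat.zero_le _)
    obtain ⟨-, ⟨h1, h2⟩ | ⟨h1, h2⟩⟩ := hcross j
    · rcases lt_or_ge (j : ℕ) i with hj | hj
      · simp [h2 _ ((hs i j).1 hj), not_below_of_above (h1 _ h0), hj]
      · simp [not_below_of_above (h1 _ ((hs i j).2 hj)), not_below_of_above (h1 _ h0), hj]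
    · rcases lt_or_ge (j : ℕ) i with hj | hj
      · simp [not_below_of_above (h2 _ ((hs i j).1 hj)), h1 _ h0, hj]
      · simp [h1 _ ((hs i j).2 hj), h1 _ h0, hj]
  · intro ρ hρ x hx y hy i h1 h2
    rcases Finset.mem_union.1 hρ with h | h
    · exact below_of_orient_pos (hc.fst_AR ρ h y hy) (hc.fst_RL y hy x hx)
        (hc.orient_ARL ρ h y hy x hx) h1 h2
    · exact below_of_orient_pos (hc.fst_BR ρ h y hy) (hc.fst_RL y hy x hx)
        (hc.orient_BRL ρ h y hy x hx) h1 h2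
  · intro x hx α hα β hβ i h1 h2
    exact below_of_orient_pos (hc.fst_BA β hβ α hα) (hc.fst_AL α hα x hx)
      (hc.orient_BAL β hβ α hα x hx) h2 h1
  · intro y hy α hα β hβ i h1 h2
    by_contra hb
    exact not_below_of_above (above_of_orient_neg (hc.fst_BA β hβ α hα) (hc.fst_AR α hα y hy)
      (hc.orient_BAR β hβ α hα y hy) (hoff β (BalancedSweep.memB hβ) i hb)
      (hoff y (BalancedSweep.memR hy) i h1)) h2
  · intro p hp q hq hpq
    have hx1 : ∀ α ∈ A, ∀ x ∈ L ∪ R, α.1 < x.1 := fun α hα x hx => by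
      rcases Finset.mem_union.1 hx with h | h
      · exact hc.fst_AL α hα x h
      · exact hc.fst_AR α hα x h
    rcases lt_or_gt_of_ne (hc.fst_inj_A p hp q hq hpq) with h | h
    · exact Or.inl fun x hx i h1 h2 =>
        below_of_orient_pos h (hx1 q hq x hx) (hc.orient_AA p hp q hq h x hx) h2 h1
    · exact Or.inr fun x hx i h1 h2 =>
        below_of_orient_pos h (hx1 p hp x hx) (hc.orient_AA q hq p hp h x hx) h2 h1
  · intro p hp q hq hpq
    have hx1 : ∀ β ∈ B, ∀ x ∈ L ∪ R, β.1 < x.1 := fun β hβ x hx => by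
      rcases Finset.mem_union.1 hx with h | h
      · exact hc.fst_BL β hβ x h
      · exact hc.fst_BR β hβ x h
    rcases lt_or_gt_of_ne (hc.fst_inj_B p hp q hq hpq) with h | h
    · exact Or.inl fun x hx i h1 h2 =>
        below_of_orient_pos h (hx1 q hq x hx) (hc.orient_BB p hp q hq h x hx) h2 h1
    · exact Or.inr fun x hx i h1 h2 =>
        below_of_orient_pos h (hx1 p hp x hx) (hc.orient_BB q hq p hp h x hx) h2 h1

/-- Upper bound on the length of semialternating paths of a column configuration. -/
theorem ColumnConfig.path_card_le {A B L R : Finset Plane} (hc : ColumnConfig A B L R) {K s : ℕ}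
    (hLK : L.card + 2 ≤ K) (hAK : A.card + R.card + 1 ≤ K)
    (hBK : B.card + R.card + 1 ≤ K)
    (h : ContainsSemialternatingPath (L ∪ R) (A ∪ B) s) : s ≤ 2 * K := by
  obtain ⟨S, hS, T, hT, hs, γ, -, hγ⟩ := h
  have eS : (S ∩ L) ∪ (S ∩ R) = S := by
    rw [← Finset.inter_union_distrib_left, Finset.inter_eq_left.2 hS]
  have eT : (T ∩ A) ∪ (T ∩ B) = T := by
    rw [← Finset.inter_union_distrib_left, Finset.inter_eq_left.2 hT]
  have hc' := hc.mono (A' := T ∩ A) (B' := T ∩ B) (L' := S ∩ L) (R' := S ∩ R)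
    Finset.inter_subset_right Finset.inter_subset_right Finset.inter_subset_right
    Finset.inter_subset_right
  rw [← eS, ← eT] at hγ
  obtain ⟨k, idx, up, hsw⟩ := hγ.exists_balancedSweep hc'
  have h1 := hsw.card_red
  have h2 := hsw.card_blue
  have h3 := Finset.card_union_of_disjoint hc'.disjoint_red
  have h4 := Finset.card_union_of_disjoint hc'.disjoint_blue
  have hL := Finset.card_le_card (Finset.inter_subset_right (s₁ := S) (s₂ := L))
  have hR := Finset.card_le_card (Finset.inter_subset_right (s₁ := S) (s₂ := R))
  have hA := Finset.card_le_card (Finset.inter_subset_right (s₁ := T) (s₂ := A))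
  have hB := Finset.card_le_card (Finset.inter_subset_right (s₁ := T) (s₂ := B))
  by_contra hlt
  -- With k > K lines of each colour, L supplies at most K - 2 blue ones, which leaves three for R.
  -- Each red column supplies at most K - |R| - 1, which leaves |R| + 2 for the other.
  refine hsw.card_bound ?_ ?_ ?_ <;> rw [eS, eT] at * <;> omega
-- The four columns: order type, general position, avoidance
/-- The point of slope `τ`, seen from the origin, on a slightly bent column near `x = c`. -/
noncomputable def col (c τ : ℝ) : Plane := (c + τ ^ 2 / 100, τ * (c + τ ^ 2 / 100))

/-- A point near `(0, -10)`. -/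
def low (ξ : ℝ) : Plane := (ξ, ξ ^ 2 - 10)

/-- The second column, near `x = -1`. -/
def columnA : Set Plane := col (-1) '' Set.Icc 1 (9 / 8)
/-- The first column, near `x = -2`. -/
def columnB : Set Plane := col (-2) '' Set.Icc 0 (1 / 8)
/-- The fourth column, near `x = 1`. -/
def columnL : Set Plane := col 1 '' Set.Icc 0 (9 / 8)
/-- The third column, near `x = 0`. -/
def columnR : Set Plane := low '' Set.Icc (-1 / 20) (1 / 20)

lemma orient_swap_left (p q r : Plane) : orient q p r = -orient p q r := by
  unfold orient; ring

lemma orient_swap_right (p q r : Plane) : orient p r q = -orient p q r := by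
  unfold orient; ring

lemma orient_ne_swap_left {p q r : Plane} (h : orient p q r ≠ 0) : orient q p r ≠ 0 := by
  rw [orient_swap_left]; exact neg_ne_zero.2 h

lemma orient_ne_swap_right {p q r : Plane} (h : orient p q r ≠ 0) : orient p r q ≠ 0 := by
  rw [orient_swap_right]; exact neg_ne_zero.2 h

lemma orient_col_col (c s t : ℝ) (r : Plane) : orient (col c s) (col c t) r =
    (t - s) * ((s + t) / 100 * (r.2 - (col c s).2) -
      (c + (s ^ 2 + s * t + t ^ 2) / 100) * (r.1 - (col c s).1)) := by
  simp only [orient, col]; ring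

/-- A Vandermonde product produced by the bend τ²/100; a straight column would give zero. The last
factor keeps its sign, since the slope term is small for c = 1 and nonnegative for c < 0. -/
lemma orient_col_col_col (c s t u : ℝ) : orient (col c s) (col c t) (col c u) =
    (t - s) * (u - s) * (u - t) * ((s * t + t * u + u * s) / 100 - c) / 100 := by
  simp only [orient, col]; ring

lemma orient_low_low (a b : ℝ) (r : Plane) : orient (low a) (low b) r =
    (b - a) * (r.2 + 10 - a ^ 2 - (a + b) * (r.1 - a)) := by
  simp only [orient, low]; ring

lemma bounds_A {p : Plane} (h : p ∈ columnA) :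
    -1 ≤ p.1 ∧ p.1 ≤ -49 / 50 ∧ -9 / 8 ≤ p.2 ∧ p.2 ≤ -49 / 50 := by
  obtain ⟨τ, ⟨h1, h2⟩, rfl⟩ := h
  simp only [col]
  have h3 : τ ^ 2 ≤ (9 / 8) ^ 2 := by gcongr
  have h4 := sq_nonneg τ
  refine ⟨by linarith, by linarith, ?_, ?_⟩ <;> nlinarith

lemma bounds_B {p : Plane} (h : p ∈ columnB) :
    -2 ≤ p.1 ∧ p.1 ≤ -99 / 50 ∧ -1 / 4 ≤ p.2 ∧ p.2 ≤ 0 := by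
  obtain ⟨τ, ⟨h1, h2⟩, rfl⟩ := h
  simp only [col]
  have h3 : τ ^ 2 ≤ (1 / 8) ^ 2 := by gcongr
  have h4 := sq_nonneg τ
  refine ⟨by linarith, by linarith, ?_, ?_⟩ <;> nlinarith

lemma bounds_L {p : Plane} (h : p ∈ columnL) :
    1 ≤ p.1 ∧ p.1 ≤ 51 / 50 ∧ 0 ≤ p.2 ∧ p.2 ≤ 6 / 5 := by
  obtain ⟨τ, ⟨h1, h2⟩, rfl⟩ := h
  simp only [col]
  have h3 : τ ^ 2 ≤ (9 / 8) ^ 2 := by gcongr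
  have h4 := sq_nonneg τ
  refine ⟨by linarith, by linarith, ?_, ?_⟩ <;> nlinarith

lemma bounds_R {p : Plane} (h : p ∈ columnR) :
    -1 / 20 ≤ p.1 ∧ p.1 ≤ 1 / 20 ∧ -10 ≤ p.2 ∧ p.2 ≤ -9 := by
  obtain ⟨ξ, ⟨h1, h2⟩, rfl⟩ := h
  simp only [low]
  refine ⟨h1, h2, ?_, ?_⟩ <;> nlinarith

/-- The term due to the bend is at least -12 · (9/4) / 100 = -0.27, too small to compensate the main
term of size 1/2. A line through two points of a column is thus nearly vertical, and its sides are
left and right. -/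
lemma col_pair_pos {c s t : ℝ} {r : Plane} (hs : s ∈ Set.Icc (0 : ℝ) (9 / 8))
    (ht : t ∈ Set.Icc (0 : ℝ) (9 / 8)) (hr2 : -12 ≤ r.2 - (col c s).2)
    (h : (c + (s ^ 2 + s * t + t ^ 2) / 100) * (r.1 - (col c s).1) < -1 / 2) :
    0 < (s + t) / 100 * (r.2 - (col c s).2) -
      (c + (s ^ 2 + s * t + t ^ 2) / 100) * (r.1 - (col c s).1) := by
  obtain ⟨s0, s1⟩ := hs
  obtain ⟨t0, t1⟩ := ht
  nlinarith [mul_nonneg (add_nonneg s0 t0) (sub_nonneg.2 hr2)]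

lemma col_pair_neg {c s t : ℝ} {r : Plane} (hs : s ∈ Set.Icc (0 : ℝ) (9 / 8))
    (ht : t ∈ Set.Icc (0 : ℝ) (9 / 8)) (hr1 : r.2 - (col c s).2 ≤ 12)
    (h : 1 / 2 < (c + (s ^ 2 + s * t + t ^ 2) / 100) * (r.1 - (col c s).1)) :
    (s + t) / 100 * (r.2 - (col c s).2) -
      (c + (s ^ 2 + s * t + t ^ 2) / 100) * (r.1 - (col c s).1) < 0 := by
  obtain ⟨s0, s1⟩ := hs
  obtain ⟨t0, t1⟩ := ht
  nlinarith [mul_nonneg (add_nonneg s0 t0) (sub_nonneg.2 hr1)]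

lemma quad_bounds {s t : ℝ} (hs : s ∈ Set.Icc (0 : ℝ) (9 / 8)) (ht : t ∈ Set.Icc (0 : ℝ) (9 / 8)) :
    0 ≤ (s ^ 2 + s * t + t ^ 2) / 100 ∧ (s ^ 2 + s * t + t ^ 2) / 100 ≤ 1 / 25 := by
  obtain ⟨s0, s1⟩ := hs
  obtain ⟨t0, t1⟩ := ht
  constructor
  · positivity
  · nlinarith [mul_nonneg s0 t0, mul_nonneg (sub_nonneg.2 s1) (sub_nonneg.2 t1)]

lemma Icc_A_subset : Set.Icc (1 : ℝ) (9 / 8) ⊆ Set.Icc 0 (9 / 8) :=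
  Set.Icc_subset_Icc (by norm_num) le_rfl

lemma Icc_B_subset : Set.Icc (0 : ℝ) (1 / 8) ⊆ Set.Icc 0 (9 / 8) :=
  Set.Icc_subset_Icc le_rfl (by norm_num)

/-- The second factor of `orient_col_col` for a third point on the right of the column `A`. -/
lemma pair_A_pos {s t : ℝ} {r : Plane} (hs : s ∈ Set.Icc (1 : ℝ) (9 / 8))
    (ht : t ∈ Set.Icc (1 : ℝ) (9 / 8)) (hr : r ∈ columnL ∪ columnR) :
    0 < (s + t) / 100 * (r.2 - (col (-1) s).2) -
      (-1 + (s ^ 2 + s * t + t ^ 2) / 100) * (r.1 - (col (-1) s).1) := by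
  obtain ⟨a1, a2, a3, a4⟩ := bounds_A ⟨s, hs, rfl⟩
  obtain ⟨q1, q2⟩ := quad_bounds (Icc_A_subset hs) (Icc_A_subset ht)
  have hb : -1 / 20 ≤ r.1 ∧ r.1 ≤ 51 / 50 ∧ -10 ≤ r.2 ∧ r.2 ≤ 6 / 5 := by
    rcases hr with h | h
    · have := bounds_L h; exact ⟨by linarith, by linarith, by linarith, by linarith⟩
    · have := bounds_R h; exact ⟨by linarith, by linarith, by linarith, by linarith⟩
  refine col_pair_pos (Icc_A_subset hs) (Icc_A_subset ht) (by linarith) ?_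
  nlinarith

lemma pair_A_neg {s t : ℝ} {r : Plane} (hs : s ∈ Set.Icc (1 : ℝ) (9 / 8))
    (ht : t ∈ Set.Icc (1 : ℝ) (9 / 8)) (hr : r ∈ columnB) :
    (s + t) / 100 * (r.2 - (col (-1) s).2) -
      (-1 + (s ^ 2 + s * t + t ^ 2) / 100) * (r.1 - (col (-1) s).1) < 0 := by
  obtain ⟨a1, a2, a3, a4⟩ := bounds_A ⟨s, hs, rfl⟩
  obtain ⟨q1, q2⟩ := quad_bounds (Icc_A_subset hs) (Icc_A_subset ht)
  have := bounds_B hr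
  refine col_pair_neg (Icc_A_subset hs) (Icc_A_subset ht) (by linarith) ?_
  nlinarith

lemma pair_B_pos {s t : ℝ} {r : Plane} (hs : s ∈ Set.Icc (0 : ℝ) (1 / 8))
    (ht : t ∈ Set.Icc (0 : ℝ) (1 / 8)) (hr : r ∈ columnA ∪ (columnL ∪ columnR)) :
    0 < (s + t) / 100 * (r.2 - (col (-2) s).2) -
      (-2 + (s ^ 2 + s * t + t ^ 2) / 100) * (r.1 - (col (-2) s).1) := by
  obtain ⟨a1, a2, a3, a4⟩ := bounds_B ⟨s, hs, rfl⟩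
  obtain ⟨q1, q2⟩ := quad_bounds (Icc_B_subset hs) (Icc_B_subset ht)
  have hb : -1 ≤ r.1 ∧ r.1 ≤ 51 / 50 ∧ -10 ≤ r.2 ∧ r.2 ≤ 6 / 5 := by
    rcases hr with h | h | h
    · have := bounds_A h; exact ⟨by linarith, by linarith, by linarith, by linarith⟩
    · have := bounds_L h; exact ⟨by linarith, by linarith, by linarith, by linarith⟩
    · have := bounds_R h; exact ⟨by linarith, by linarith, by linarith, by linarith⟩
  refine col_pair_pos (Icc_B_subset hs) (Icc_B_subset ht) (by linarith) ?_
  nlinarith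

lemma pair_L_pos {s t : ℝ} {r : Plane} (hs : s ∈ Set.Icc (0 : ℝ) (9 / 8))
    (ht : t ∈ Set.Icc (0 : ℝ) (9 / 8)) (hr : r ∈ columnA ∪ (columnB ∪ columnR)) :
    0 < (s + t) / 100 * (r.2 - (col 1 s).2) -
      (1 + (s ^ 2 + s * t + t ^ 2) / 100) * (r.1 - (col 1 s).1) := by
  obtain ⟨a1, a2, a3, a4⟩ := bounds_L ⟨s, hs, rfl⟩
  obtain ⟨q1, q2⟩ := quad_bounds hs ht
  have hb : r.1 ≤ 1 / 20 ∧ -10 ≤ r.2 ∧ r.2 ≤ 6 / 5 := by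
    rcases hr with h | h | h
    · have := bounds_A h; exact ⟨by linarith, by linarith, by linarith⟩
    · have := bounds_B h; exact ⟨by linarith, by linarith, by linarith⟩
    · have := bounds_R h; exact ⟨by linarith, by linarith, by linarith⟩
  refine col_pair_pos hs ht (by linarith) ?_
  nlinarith

lemma pair_R_pos {a b : ℝ} {r : Plane} (ha : a ∈ Set.Icc (-1 / 20 : ℝ) (1 / 20))
    (hb : b ∈ Set.Icc (-1 / 20 : ℝ) (1 / 20)) (hr : r ∈ columnA ∪ (columnB ∪ columnL)) :
    0 < r.2 + 10 - a ^ 2 - (a + b) * (r.1 - a) := by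
  obtain ⟨a0, a1⟩ := ha
  obtain ⟨b0, b1⟩ := hb
  have hb : -2 ≤ r.1 ∧ r.1 ≤ 51 / 50 ∧ -9 / 8 ≤ r.2 := by
    rcases hr with h | h | h
    · have := bounds_A h; exact ⟨by linarith, by linarith, by linarith⟩
    · have := bounds_B h; exact ⟨by linarith, by linarith, by linarith⟩
    · have := bounds_L h; exact ⟨by linarith, by linarith, by linarith⟩
  obtain ⟨h1, h2, h3⟩ := hb
  have h4 : |(a + b) * (r.1 - a)| ≤ 1 / 10 * 3 := by
    rw [abs_mul]
    exact mul_le_mul (abs_le.2 ⟨by linarith, by linarith⟩) (abs_le.2 ⟨by linarith, by linarith⟩)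
      (abs_nonneg _) (by norm_num)
  have h5 := (abs_le.1 h4).2
  nlinarith

lemma orient_columns_ARL {α y x : Plane} (hα : α ∈ columnA) (hy : y ∈ columnR)
    (hx : x ∈ columnL) : 0 < orient α y x := by
  obtain ⟨a1, a2, a3, a4⟩ := bounds_A hα
  obtain ⟨b1, b2, b3, b4⟩ := bounds_R hy
  obtain ⟨c1, c2, c3, c4⟩ := bounds_L hx
  unfold orient
  nlinarith [mul_nonneg (by linarith : 0 ≤ y.1 - α.1) (by linarith : 0 ≤ x.2 - α.2),
    mul_nonneg (by linarith : 0 ≤ α.2 - y.2 - 7) (by linarith : 0 ≤ x.1 - α.1)]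

lemma orient_columns_BRL {β y x : Plane} (hβ : β ∈ columnB) (hy : y ∈ columnR)
    (hx : x ∈ columnL) : 0 < orient β y x := by
  obtain ⟨a1, a2, a3, a4⟩ := bounds_B hβ
  obtain ⟨b1, b2, b3, b4⟩ := bounds_R hy
  obtain ⟨c1, c2, c3, c4⟩ := bounds_L hx
  unfold orient
  nlinarith [mul_nonneg (by linarith : 0 ≤ y.1 - β.1) (by linarith : 0 ≤ x.2 - β.2),
    mul_nonneg (by linarith : 0 ≤ β.2 - y.2 - 7) (by linarith : 0 ≤ x.1 - β.1)]

/-- Segments from B to L stay above height -1/4, whereas A lies below -49/50. -/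
lemma orient_columns_BAL {β α x : Plane} (hβ : β ∈ columnB) (hα : α ∈ columnA)
    (hx : x ∈ columnL) : 0 < orient β α x := by
  obtain ⟨a1, a2, a3, a4⟩ := bounds_B hβ
  obtain ⟨b1, b2, b3, b4⟩ := bounds_A hα
  obtain ⟨c1, c2, c3, c4⟩ := bounds_L hx
  unfold orient
  nlinarith [mul_nonneg (by linarith : 0 ≤ α.1 - β.1) (by linarith : 0 ≤ x.2 - β.2),
    mul_nonneg (by linarith : 0 ≤ β.2 - α.2 - 1 / 2) (by linarith : 0 ≤ x.1 - β.1)]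

/-- Segments from B to R drop to about -5 over x = -1, far below A: R sees the two red columns in
the order opposite to that of L. -/
lemma orient_columns_BAR {β α y : Plane} (hβ : β ∈ columnB) (hα : α ∈ columnA)
    (hy : y ∈ columnR) : orient β α y < 0 := by
  obtain ⟨a1, a2, a3, a4⟩ := bounds_B hβ
  obtain ⟨b1, b2, b3, b4⟩ := bounds_A hα
  obtain ⟨c1, c2, c3, c4⟩ := bounds_R hy
  unfold orient
  nlinarith [mul_nonneg (by linarith : 0 ≤ α.1 - β.1 - 9 / 10) (by linarith : 0 ≤ β.2 - y.2 - 8),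
    mul_nonneg (by linarith : 0 ≤ 9 / 8 - (β.2 - α.2)) (by linarith : 0 ≤ y.1 - β.1)]

lemma fst_col_lt {c s t : ℝ} (hs : 0 ≤ s) (h : s < t) : (col c s).1 < (col c t).1 := by
  simp only [col]; gcongr

lemma lt_of_fst_col_lt {c s t : ℝ} (ht : 0 ≤ t) (h : (col c s).1 < (col c t).1) : s < t := by
  simp only [col, add_lt_add_iff_left] at h
  exact lt_of_pow_lt_pow_left₀ 2 ht (by linarith)

lemma fst_col_ne {c s t : ℝ} (hs : 0 ≤ s) (ht : 0 ≤ t) (h : s ≠ t) :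
    (col c s).1 ≠ (col c t).1 := by
  rcases lt_or_gt_of_ne h with h | h
  · exact (fst_col_lt hs h).ne
  · exact (fst_col_lt ht h).ne'

/-- Finite subsets of the four columns form a column configuration. -/
theorem columnConfig_of_subset {A B L R : Finset Plane} (hA : (A : Set Plane) ⊆ columnA)
    (hB : (B : Set Plane) ⊆ columnB) (hL : (L : Set Plane) ⊆ columnL)
    (hR : (R : Set Plane) ⊆ columnR) : ColumnConfig A B L R where
  fst_BA p hp q hq := by have := bounds_B (hB hp); have := bounds_A (hA hq); linarith
  fst_AR p hp q hq := by have := bounds_A (hA hp); have := bounds_R (hR hq); linarith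
  fst_BR p hp q hq := by have := bounds_B (hB hp); have := bounds_R (hR hq); linarith
  fst_AL p hp q hq := by have := bounds_A (hA hp); have := bounds_L (hL hq); linarith
  fst_BL p hp q hq := by have := bounds_B (hB hp); have := bounds_L (hL hq); linarith
  fst_RL p hp q hq := by have := bounds_R (hR hp); have := bounds_L (hL hq); linarith
  fst_inj_A p hp q hq hpq := by
    obtain ⟨s, hs, rfl⟩ := hA hp
    obtain ⟨t, ht, rfl⟩ := hA hq
    exact fst_col_ne (Icc_A_subset hs).1 (Icc_A_subset ht).1 fun e => hpq (by rw [e])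
  fst_inj_B p hp q hq hpq := by
    obtain ⟨s, hs, rfl⟩ := hB hp
    obtain ⟨t, ht, rfl⟩ := hB hq
    exact fst_col_ne hs.1 ht.1 fun e => hpq (by rw [e])
  orient_ARL _ h1 _ h2 _ h3 := orient_columns_ARL (hA h1) (hR h2) (hL h3)
  orient_BRL _ h1 _ h2 _ h3 := orient_columns_BRL (hB h1) (hR h2) (hL h3)
  orient_BAL _ h1 _ h2 _ h3 := orient_columns_BAL (hB h1) (hA h2) (hL h3)
  orient_BAR _ h1 _ h2 _ h3 := orient_columns_BAR (hB h1) (hA h2) (hR h3)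
  orient_AA p hp q hq hpq x hx := by
    obtain ⟨s, hs, rfl⟩ := hA hp
    obtain ⟨t, ht, rfl⟩ := hA hq
    rw [orient_col_col]
    exact mul_pos (sub_pos.2 (lt_of_fst_col_lt (Icc_A_subset ht).1 hpq))
      (pair_A_pos hs ht ((Finset.mem_union.1 hx).imp (fun h => hL h) (fun h => hR h)))
  orient_BB p hp q hq hpq x hx := by
    obtain ⟨s, hs, rfl⟩ := hB hp
    obtain ⟨t, ht, rfl⟩ := hB hq
    rw [orient_col_col]
    exact mul_pos (sub_pos.2 (lt_of_fst_col_lt ht.1 hpq))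
      (pair_B_pos hs ht (Or.inr ((Finset.mem_union.1 hx).imp (fun h => hL h) (fun h => hR h))))

lemma param_sub_ne {f : ℝ → Plane} {s t : ℝ} (h : f s ≠ f t) : t - s ≠ 0 :=
  sub_ne_zero.2 fun e => h (by rw [e])

lemma orient_ne_AA {p q r : Plane} (hp : p ∈ columnA) (hq : q ∈ columnA)
    (hr : r ∈ columnB ∪ (columnL ∪ columnR)) (hpq : p ≠ q) : orient p q r ≠ 0 := by
  obtain ⟨s, hs, rfl⟩ := hp
  obtain ⟨t, ht, rfl⟩ := hq
  rw [orient_col_col]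
  refine mul_ne_zero (param_sub_ne hpq) ?_
  rcases hr with h | h
  · exact (pair_A_neg hs ht h).ne
  · exact (pair_A_pos hs ht h).ne'

lemma orient_ne_BB {p q r : Plane} (hp : p ∈ columnB) (hq : q ∈ columnB)
    (hr : r ∈ columnA ∪ (columnL ∪ columnR)) (hpq : p ≠ q) : orient p q r ≠ 0 := by
  obtain ⟨s, hs, rfl⟩ := hp
  obtain ⟨t, ht, rfl⟩ := hq
  rw [orient_col_col]
  exact mul_ne_zero (param_sub_ne hpq) (pair_B_pos hs ht hr).ne'

lemma orient_ne_LL {p q r : Plane} (hp : p ∈ columnL) (hq : q ∈ columnL)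
    (hr : r ∈ columnA ∪ (columnB ∪ columnR)) (hpq : p ≠ q) : orient p q r ≠ 0 := by
  obtain ⟨s, hs, rfl⟩ := hp
  obtain ⟨t, ht, rfl⟩ := hq
  rw [orient_col_col]
  exact mul_ne_zero (param_sub_ne hpq) (pair_L_pos hs ht hr).ne'

lemma orient_ne_RR {p q r : Plane} (hp : p ∈ columnR) (hq : q ∈ columnR)
    (hr : r ∈ columnA ∪ (columnB ∪ columnL)) (hpq : p ≠ q) : orient p q r ≠ 0 := by
  obtain ⟨s, hs, rfl⟩ := hp
  obtain ⟨t, ht, rfl⟩ := hq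
  rw [orient_low_low]
  exact mul_ne_zero (param_sub_ne hpq) (pair_R_pos hs ht hr).ne'

lemma orient_ne_col {c s t u : ℝ} (hs : s ∈ Set.Icc (0 : ℝ) (9 / 8))
    (ht : t ∈ Set.Icc (0 : ℝ) (9 / 8)) (hu : u ∈ Set.Icc (0 : ℝ) (9 / 8)) (hc : c < 0 ∨ c = 1)
    (h1 : col c s ≠ col c t) (h2 : col c t ≠ col c u) (h3 : col c s ≠ col c u) :
    orient (col c s) (col c t) (col c u) ≠ 0 := by
  rw [orient_col_col_col]
  refine div_ne_zero (mul_ne_zero (mul_ne_zero (mul_ne_zero (param_sub_ne h1) (param_sub_ne h3))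
    (param_sub_ne h2)) ?_) (by norm_num)
  obtain ⟨s0, s1⟩ := hs
  obtain ⟨t0, t1⟩ := ht
  obtain ⟨u0, u1⟩ := hu
  rcases hc with hc | rfl
  · have : 0 ≤ s * t + t * u + u * s := by positivity
    exact ne_of_gt (by linarith)
  · have h4 : s * t ≤ 9 / 8 * (9 / 8) := mul_le_mul s1 t1 t0 (by norm_num)
    have h5 : t * u ≤ 9 / 8 * (9 / 8) := mul_le_mul t1 u1 u0 (by norm_num)
    have h6 : u * s ≤ 9 / 8 * (9 / 8) := mul_le_mul u1 s1 s0 (by norm_num)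
    exact ne_of_lt (by linarith)

lemma orient_ne_AAA {p q r : Plane} (hp : p ∈ columnA) (hq : q ∈ columnA) (hr : r ∈ columnA)
    (h1 : p ≠ q) (h2 : q ≠ r) (h3 : p ≠ r) : orient p q r ≠ 0 := by
  obtain ⟨s, hs, rfl⟩ := hp
  obtain ⟨t, ht, rfl⟩ := hq
  obtain ⟨u, hu, rfl⟩ := hr
  exact orient_ne_col (Icc_A_subset hs) (Icc_A_subset ht) (Icc_A_subset hu)
    (Or.inl (by norm_num)) h1 h2 h3

lemma orient_ne_BBB {p q r : Plane} (hp : p ∈ columnB) (hq : q ∈ columnB) (hr : r ∈ columnB)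
    (h1 : p ≠ q) (h2 : q ≠ r) (h3 : p ≠ r) : orient p q r ≠ 0 := by
  obtain ⟨s, hs, rfl⟩ := hp
  obtain ⟨t, ht, rfl⟩ := hq
  obtain ⟨u, hu, rfl⟩ := hr
  exact orient_ne_col (Icc_B_subset hs) (Icc_B_subset ht) (Icc_B_subset hu)
    (Or.inl (by norm_num)) h1 h2 h3

lemma orient_ne_LLL {p q r : Plane} (hp : p ∈ columnL) (hq : q ∈ columnL) (hr : r ∈ columnL)
    (h1 : p ≠ q) (h2 : q ≠ r) (h3 : p ≠ r) : orient p q r ≠ 0 := by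
  obtain ⟨s, hs, rfl⟩ := hp
  obtain ⟨t, ht, rfl⟩ := hq
  obtain ⟨u, hu, rfl⟩ := hr
  exact orient_ne_col hs ht hu (Or.inr rfl) h1 h2 h3

lemma orient_ne_RRR {p q r : Plane} (hp : p ∈ columnR) (hq : q ∈ columnR) (hr : r ∈ columnR)
    (h1 : p ≠ q) (h2 : q ≠ r) (h3 : p ≠ r) : orient p q r ≠ 0 := by
  obtain ⟨s, hs, rfl⟩ := hp
  obtain ⟨t, ht, rfl⟩ := hq
  obtain ⟨u, hu, rfl⟩ := hr
  have : orient (low s) (low t) (low u) = (t - s) * ((u - s) * (u - t)) := by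
    simp only [orient, low]; ring
  rw [this]
  exact mul_ne_zero (param_sub_ne h1) (mul_ne_zero (param_sub_ne h3) (param_sub_ne h2))

lemma orient_ne_zero_of_A {p q r : Plane} (hp : p ∈ columnA) (hq : q ∈ columnA)
    (hr : r ∈ (columnA ∪ columnB) ∪ (columnL ∪ columnR))
    (h1 : p ≠ q) (h2 : q ≠ r) (h3 : p ≠ r) : orient p q r ≠ 0 := by
  rcases hr with (h | h) | h
  · exact orient_ne_AAA hp hq h h1 h2 h3
  · exact orient_ne_AA hp hq (Or.inl h) h1
  · exact orient_ne_AA hp hq (Or.inr h) h1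

lemma orient_ne_zero_of_B {p q r : Plane} (hp : p ∈ columnB) (hq : q ∈ columnB)
    (hr : r ∈ (columnA ∪ columnB) ∪ (columnL ∪ columnR))
    (h1 : p ≠ q) (h2 : q ≠ r) (h3 : p ≠ r) : orient p q r ≠ 0 := by
  rcases hr with (h | h) | h
  · exact orient_ne_BB hp hq (Or.inl h) h1
  · exact orient_ne_BBB hp hq h h1 h2 h3
  · exact orient_ne_BB hp hq (Or.inr h) h1

lemma orient_ne_zero_of_L {p q r : Plane} (hp : p ∈ columnL) (hq : q ∈ columnL)
    (hr : r ∈ (columnA ∪ columnB) ∪ (columnL ∪ columnR))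
    (h1 : p ≠ q) (h2 : q ≠ r) (h3 : p ≠ r) : orient p q r ≠ 0 := by
  rcases hr with (h | h) | (h | h)
  · exact orient_ne_LL hp hq (Or.inl h) h1
  · exact orient_ne_LL hp hq (Or.inr (Or.inl h)) h1
  · exact orient_ne_LLL hp hq h h1 h2 h3
  · exact orient_ne_LL hp hq (Or.inr (Or.inr h)) h1

lemma orient_ne_zero_of_R {p q r : Plane} (hp : p ∈ columnR) (hq : q ∈ columnR)
    (hr : r ∈ (columnA ∪ columnB) ∪ (columnL ∪ columnR))
    (h1 : p ≠ q) (h2 : q ≠ r) (h3 : p ≠ r) : orient p q r ≠ 0 := by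
  rcases hr with (h | h) | (h | h)
  · exact orient_ne_RR hp hq (Or.inl h) h1
  · exact orient_ne_RR hp hq (Or.inr (Or.inl h)) h1
  · exact orient_ne_RR hp hq (Or.inr (Or.inr h)) h1
  · exact orient_ne_RRR hp hq h h1 h2 h3

/-- No three points of the four columns are collinear. -/
lemma orient_ne_zero {p q r : Plane}
    (hp : p ∈ (columnA ∪ columnB) ∪ (columnL ∪ columnR))
    (hq : q ∈ (columnA ∪ columnB) ∪ (columnL ∪ columnR))
    (hr : r ∈ (columnA ∪ columnB) ∪ (columnL ∪ columnR))
    (h1 : p ≠ q) (h2 : q ≠ r) (h3 : p ≠ r) : orient p q r ≠ 0 := by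
  rcases id hp with (a | a) | (a | a) <;> rcases id hq with (b | b) | (b | b)
  · exact orient_ne_zero_of_A a b hr h1 h2 h3
  · rcases hr with (c | c) | (c | c)
    · exact orient_ne_swap_right (orient_ne_zero_of_A a c hq h3 h2.symm h1)
    · exact orient_ne_swap_left (orient_ne_swap_right
        (orient_ne_zero_of_B b c hp h2 h3.symm h1.symm))
    · exact orient_ne_swap_left ((orient_columns_BAL b a c).ne')
    · exact orient_ne_swap_left ((orient_columns_BAR b a c).ne)
  · rcases hr with (c | c) | (c | c)
    · exact orient_ne_swap_right (orient_ne_zero_of_A a c hq h3 h2.symm h1)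
    · exact orient_ne_swap_right (orient_ne_swap_left ((orient_columns_BAL c a b).ne'))
    · exact orient_ne_swap_left (orient_ne_swap_right
        (orient_ne_zero_of_L b c hp h2 h3.symm h1.symm))
    · exact orient_ne_swap_right ((orient_columns_ARL a c b).ne')
  · rcases hr with (c | c) | (c | c)
    · exact orient_ne_swap_right (orient_ne_zero_of_A a c hq h3 h2.symm h1)
    · exact orient_ne_swap_right (orient_ne_swap_left ((orient_columns_BAR c a b).ne))
    · exact (orient_columns_ARL a b c).ne'
    · exact orient_ne_swap_left (orient_ne_swap_right
        (orient_ne_zero_of_R b c hp h2 h3.symm h1.symm))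
  · rcases hr with (c | c) | (c | c)
    · exact orient_ne_swap_left (orient_ne_swap_right
        (orient_ne_zero_of_A b c hp h2 h3.symm h1.symm))
    · exact orient_ne_swap_right (orient_ne_zero_of_B a c hq h3 h2.symm h1)
    · exact (orient_columns_BAL a b c).ne'
    · exact (orient_columns_BAR a b c).ne
  · exact orient_ne_zero_of_B a b hr h1 h2 h3
  · rcases hr with (c | c) | (c | c)
    · exact orient_ne_swap_right ((orient_columns_BAL a c b).ne')
    · exact orient_ne_swap_right (orient_ne_zero_of_B a c hq h3 h2.symm h1)
    · exact orient_ne_swap_left (orient_ne_swap_right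
        (orient_ne_zero_of_L b c hp h2 h3.symm h1.symm))
    · exact orient_ne_swap_right ((orient_columns_BRL a c b).ne')
  · rcases hr with (c | c) | (c | c)
    · exact orient_ne_swap_right ((orient_columns_BAR a c b).ne)
    · exact orient_ne_swap_right (orient_ne_zero_of_B a c hq h3 h2.symm h1)
    · exact (orient_columns_BRL a b c).ne'
    · exact orient_ne_swap_left (orient_ne_swap_right
        (orient_ne_zero_of_R b c hp h2 h3.symm h1.symm))
  · rcases hr with (c | c) | (c | c)
    · exact orient_ne_swap_left (orient_ne_swap_right
        (orient_ne_zero_of_A b c hp h2 h3.symm h1.symm))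
    · exact orient_ne_swap_left (orient_ne_swap_right (orient_ne_swap_left ((orient_columns_BAL c b a).ne')))
    · exact orient_ne_swap_right (orient_ne_zero_of_L a c hq h3 h2.symm h1)
    · exact orient_ne_swap_left (orient_ne_swap_right ((orient_columns_ARL b c a).ne'))
  · rcases hr with (c | c) | (c | c)
    · exact orient_ne_swap_left (orient_ne_swap_right ((orient_columns_BAL b c a).ne'))
    · exact orient_ne_swap_left (orient_ne_swap_right
        (orient_ne_zero_of_B b c hp h2 h3.symm h1.symm))
    · exact orient_ne_swap_right (orient_ne_zero_of_L a c hq h3 h2.symm h1)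
    · exact orient_ne_swap_left (orient_ne_swap_right ((orient_columns_BRL b c a).ne'))
  · exact orient_ne_zero_of_L a b hr h1 h2 h3
  · rcases hr with (c | c) | (c | c)
    · exact orient_ne_swap_left (orient_ne_swap_right (orient_ne_swap_left ((orient_columns_ARL c b a).ne')))
    · exact orient_ne_swap_left (orient_ne_swap_right (orient_ne_swap_left ((orient_columns_BRL c b a).ne')))
    · exact orient_ne_swap_right (orient_ne_zero_of_L a c hq h3 h2.symm h1)
    · exact orient_ne_swap_left (orient_ne_swap_right
        (orient_ne_zero_of_R b c hp h2 h3.symm h1.symm))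
  · rcases hr with (c | c) | (c | c)
    · exact orient_ne_swap_left (orient_ne_swap_right
        (orient_ne_zero_of_A b c hp h2 h3.symm h1.symm))
    · exact orient_ne_swap_left (orient_ne_swap_right (orient_ne_swap_left ((orient_columns_BAR c b a).ne)))
    · exact orient_ne_swap_left ((orient_columns_ARL b a c).ne')
    · exact orient_ne_swap_right (orient_ne_zero_of_R a c hq h3 h2.symm h1)
  · rcases hr with (c | c) | (c | c)
    · exact orient_ne_swap_left (orient_ne_swap_right ((orient_columns_BAR b c a).ne))
    · exact orient_ne_swap_left (orient_ne_swap_right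
        (orient_ne_zero_of_B b c hp h2 h3.symm h1.symm))
    · exact orient_ne_swap_left ((orient_columns_BRL b a c).ne')
    · exact orient_ne_swap_right (orient_ne_zero_of_R a c hq h3 h2.symm h1)
  · rcases hr with (c | c) | (c | c)
    · exact orient_ne_swap_right (orient_ne_swap_left ((orient_columns_ARL c a b).ne'))
    · exact orient_ne_swap_right (orient_ne_swap_left ((orient_columns_BRL c a b).ne'))
    · exact orient_ne_swap_left (orient_ne_swap_right
        (orient_ne_zero_of_L b c hp h2 h3.symm h1.symm))
    · exact orient_ne_swap_right (orient_ne_zero_of_R a c hq h3 h2.symm h1)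
  · exact orient_ne_zero_of_R a b hr h1 h2 h3

lemma orient_eq_zero_of_collinear {p q r : Plane} (h : Collinear ℝ {p, q, r}) :
    orient p q r = 0 := by
  obtain ⟨v, hv⟩ := (collinear_iff_of_mem (p₀ := p) (by simp)).1 h
  obtain ⟨a, ha⟩ := hv q (by simp)
  obtain ⟨b, hb⟩ := hv r (by simp)
  subst ha hb
  simp only [orient, vadd_eq_add, Prod.fst_add, Prod.snd_add, Prod.smul_fst, Prod.smul_snd,
    smul_eq_mul]
  ring

lemma fst_ne_of_mem_columns {p q : Plane}
    (hp : p ∈ (columnA ∪ columnB) ∪ (columnL ∪ columnR))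
    (hq : q ∈ (columnA ∪ columnB) ∪ (columnL ∪ columnR)) (h : p ≠ q) : p.1 ≠ q.1 := by
  have same : ∀ {c : ℝ} {I : Set ℝ}, I ⊆ Set.Icc 0 (9 / 8) → p ∈ col c '' I → q ∈ col c '' I →
      p.1 ≠ q.1 := by
    rintro c I hI ⟨s, hs, rfl⟩ ⟨t, ht, rfl⟩
    exact fst_col_ne (hI hs).1 (hI ht).1 fun e => h (by rw [e])
  rcases hp with (hp | hp) | (hp | hp) <;> rcases hq with (hq | hq) | (hq | hq)
  · exact same Icc_A_subset hp hq
  · have := bounds_A hp; have := bounds_B hq; intro e; linarith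
  · have := bounds_A hp; have := bounds_L hq; intro e; linarith
  · have := bounds_A hp; have := bounds_R hq; intro e; linarith
  · have := bounds_B hp; have := bounds_A hq; intro e; linarith
  · exact same Icc_B_subset hp hq
  · have := bounds_B hp; have := bounds_L hq; intro e; linarith
  · have := bounds_B hp; have := bounds_R hq; intro e; linarith
  · have := bounds_L hp; have := bounds_A hq; intro e; linarith
  · have := bounds_L hp; have := bounds_B hq; intro e; linarith
  · exact same subset_rfl hp hq
  · have := bounds_L hp; have := bounds_R hq; intro e; linarith
  · have := bounds_R hp; have := bounds_A hq; intro e; linarith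
  · have := bounds_R hp; have := bounds_B hq; intro e; linarith
  · have := bounds_R hp; have := bounds_L hq; intro e; linarith
  · obtain ⟨s, hs, rfl⟩ := hp
    obtain ⟨t, ht, rfl⟩ := hq
    intro e
    exact h (congrArg low e)

theorem generalPosition_of_subset {P : Set Plane}
    (hP : P ⊆ (columnA ∪ columnB) ∪ (columnL ∪ columnR)) : GeneralPosition P :=
  ⟨fun _ hp _ hq _ hr h1 h2 h3 h =>
    orient_ne_zero (hP hp) (hP hq) (hP hr) h1 h2 h3 (orient_eq_zero_of_collinear h),
  fun _ hp _ hq h => fst_ne_of_mem_columns (hP hp) (hP hq) h⟩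

lemma orient_combo (p q x y : Plane) {a b : ℝ} (hab : a + b = 1) :
    orient p q (a • x + b • y) = a * orient p q x + b * orient p q y := by
  obtain rfl : b = 1 - a := by linarith
  simp only [orient, Prod.fst_add, Prod.snd_add, Prod.smul_fst, Prod.smul_snd, smul_eq_mul]
  ring

/-- The open half-plane on one side of the line is convex, so it contains the hull with `S`. -/
lemma disjoint_line_convexHull {p q : Plane} {S : Set Plane} (h : ∀ r ∈ S, 0 < orient p q r) :
    Disjoint (line[ℝ, p, q] : Set Plane) (convexHull ℝ S) := by
  have hconv : Convex ℝ {z | 0 < orient p q z} := by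
    intro x hx y hy a b ha hb hab
    have hx : 0 < orient p q x := hx
    have hy : 0 < orient p q y := hy
    change 0 < orient p q (a • x + b • y)
    rw [orient_combo p q x y hab]
    rcases ha.eq_or_lt with rfl | ha
    · have : b = 1 := by linarith
      subst this; simpa using hy
    · exact add_pos_of_pos_of_nonneg (mul_pos ha hx) (mul_nonneg hb hy.le)
  have hsub : convexHull ℝ S ⊆ {z | 0 < orient p q z} := convexHull_min h hconv
  refine Set.disjoint_left.2 fun z hz hz' => ?_
  have h1 : 0 < orient p q z := hsub hz'
  have h2 := orient_eq_zero_of_collinear (collinear_insert_of_mem_affineSpan_pair hz)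
  unfold orient at h1 h2
  linarith

lemma disjoint_line_convexHull_or {p q : Plane} {S : Set Plane}
    (h : (∀ r ∈ S, 0 < orient p q r) ∨ (∀ r ∈ S, 0 < orient q p r)) :
    Disjoint (line[ℝ, p, q] : Set Plane) (convexHull ℝ S) := by
  rcases h with h | h
  · exact disjoint_line_convexHull h
  · rw [Set.pair_comm]
    exact disjoint_line_convexHull h

theorem isOneAvoiding_of_subset {S T : Set Plane} (hS : S ⊆ columnL ∪ columnR)
    (hT : T ⊆ columnA ∪ columnB) : IsOneAvoiding S T := by
  refine ⟨⟨-1 / 2, fun r hr => ?_, fun b hb => ?_⟩, fun p hp q hq hpq => ?_⟩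
  · rcases hT hr with h | h
    · have := bounds_A h; linarith
    · have := bounds_B h; linarith
  · rcases hS hb with h | h
    · have := bounds_L h; linarith
    · have := bounds_R h; linarith
  have hRL : ∀ {y x : Plane}, y ∈ columnR → x ∈ columnL → ∀ r ∈ T, 0 < orient y x r := by
    intro y x hy hx r hr
    have : orient y x r = orient r y x := by unfold orient; ring
    rw [this]
    rcases hT hr with h | h
    · exact orient_columns_ARL h hy hx
    · exact orient_columns_BRL h hy hx
  apply disjoint_line_convexHull_or
  rcases hS hp with hp | hp <;> rcases hS hq with hq | hq
  · obtain ⟨s, hs, rfl⟩ := hp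
    obtain ⟨t, ht, rfl⟩ := hq
    have hT' : ∀ r ∈ T, r ∈ columnA ∪ (columnB ∪ columnR) := fun r hr =>
      (hT hr).imp id Or.inl
    rcases lt_or_gt_of_ne (sub_ne_zero.1 (param_sub_ne hpq)) with h | h
    · right; intro r hr
      rw [orient_col_col]
      exact mul_pos (sub_pos.2 h) (pair_L_pos ht hs (hT' r hr))
    · left; intro r hr
      rw [orient_col_col]
      exact mul_pos (sub_pos.2 h) (pair_L_pos hs ht (hT' r hr))
  · exact Or.inr (hRL hq hp)
  · exact Or.inl (hRL hp hq)
  · obtain ⟨s, hs, rfl⟩ := hp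
    obtain ⟨t, ht, rfl⟩ := hq
    have hT' : ∀ r ∈ T, r ∈ columnA ∪ (columnB ∪ columnL) := fun r hr =>
      (hT hr).imp id Or.inl
    rcases lt_or_gt_of_ne (sub_ne_zero.1 (param_sub_ne hpq)) with h | h
    · right; intro r hr
      rw [orient_low_low]
      exact mul_pos (sub_pos.2 h) (pair_R_pos ht hs (hT' r hr))
    · left; intro r hr
      rw [orient_low_low]
      exact mul_pos (sub_pos.2 h) (pair_R_pos hs ht (hT' r hr))
-- The 22m points and the long path
/-- The slopes used in the construction. -/
noncomputable def pointSlope (m i : ℕ) : ℝ := i / (176 * m) + if i < 10 * m then 0 else 1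

/-- The red points, in the order of their slopes. -/
noncomputable def redPoint (m j : ℕ) : Plane :=
  col (if j < 5 * m then -2 else -1) (pointSlope m (2 * j))

/-- The blue points near `(1, 0)`, in the order of their slopes. -/
noncomputable def leftPoint (m j : ℕ) : Plane := col 1 (pointSlope m (2 * (j + m) + 1))

/-- The blue points near `(0, -10)`. -/
noncomputable def rightPoint (m j : ℕ) : Plane := low ((2 * j - 1) / (80 * m))

lemma pointSlope_strictMono {m : ℕ} (hm : 0 < m) : StrictMono (pointSlope m) := by
  intro i j hij
  unfold pointSlope
  have hm' : (0 : ℝ) < 176 * m := by positivity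
  refine add_lt_add_of_lt_of_le (div_lt_div_of_pos_right (by exact_mod_cast hij) hm') ?_
  split_ifs <;> first | omega | norm_num

/-- The denominator 176m = 8 · 22m makes the 22m slopes advance by less than 1/8 in total, apart
from the jump by 1 that separates the columns B and A. -/
lemma pointSlope_mem {m i : ℕ} (hm : 0 < m) (hi : i < 22 * m) : pointSlope m i ∈ Set.Icc (0 : ℝ) (9 / 8) := by
  have hm' : (0 : ℝ) < 176 * m := by positivity
  have h1 : (i : ℝ) / (176 * m) ≤ 1 / 8 := by
    rw [div_le_iff₀ hm']
    have : (i : ℝ) < 22 * m := by exact_mod_cast hi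
    linarith
  have h2 : (0 : ℝ) ≤ i / (176 * m) := by positivity
  unfold pointSlope
  constructor <;> split_ifs <;> linarith

lemma pointSlope_mem_low {m i : ℕ} (hm : 0 < m) (hi : i < 10 * m) :
    pointSlope m i ∈ Set.Icc (0 : ℝ) (1 / 8) := by
  have hm' : (0 : ℝ) < 176 * m := by positivity
  have h1 : (i : ℝ) / (176 * m) ≤ 1 / 8 := by
    rw [div_le_iff₀ hm']
    have : (i : ℝ) < 10 * m := by exact_mod_cast hi
    linarith
  have h2 : (0 : ℝ) ≤ i / (176 * m) := by positivity
  unfold pointSlope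
  rw [if_pos hi, add_zero]
  exact ⟨h2, h1⟩

lemma pointSlope_mem_high {m i : ℕ} (hm : 0 < m) (hi : 10 * m ≤ i) (hi' : i < 22 * m) :
    pointSlope m i ∈ Set.Icc (1 : ℝ) (9 / 8) := by
  refine ⟨?_, (pointSlope_mem hm hi').2⟩
  have h2 : (0 : ℝ) ≤ i / (176 * m) := by positivity
  unfold pointSlope
  rw [if_neg (not_lt.2 hi)]
  linarith

lemma redPoint_mem_B {m j : ℕ} (hm : 0 < m) (hj : j < 5 * m) : redPoint m j ∈ columnB := by
  unfold redPoint
  rw [if_pos hj]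
  exact ⟨_, pointSlope_mem_low hm (by omega), rfl⟩

lemma redPoint_mem_A {m j : ℕ} (hm : 0 < m) (hj : 5 * m ≤ j) (hj' : j < 11 * m) :
    redPoint m j ∈ columnA := by
  unfold redPoint
  rw [if_neg (not_lt.2 hj)]
  exact ⟨_, pointSlope_mem_high hm (by omega) (by omega), rfl⟩

lemma leftPoint_mem {m j : ℕ} (hm : 0 < m) (hj : j < 10 * m) : leftPoint m j ∈ columnL :=
  ⟨_, pointSlope_mem hm (by omega), rfl⟩

lemma rightPoint_mem {m j : ℕ} (hm : 0 < m) (hj : j < m + 2) : rightPoint m j ∈ columnR := by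
  have h1 : (1 : ℝ) ≤ m := by exact_mod_cast hm
  have h2 : (j : ℝ) ≤ m + 1 := by exact_mod_cast Nat.lt_succ_iff.1 hj
  have h3 : (0 : ℝ) ≤ j := Nat.cast_nonneg j
  refine ⟨_, ⟨?_, ?_⟩, rfl⟩
  · rw [le_div_iff₀ (by positivity)]; linarith
  · rw [div_le_iff₀ (by positivity)]; linarith

/-- `τ` is the slope of the line through the origin and `p`. -/
def HasSlope (p : Plane) (τ : ℝ) : Prop := p.1 ≠ 0 ∧ p.2 = p.1 * τ

lemma HasSlope.unique {p : Plane} {σ τ : ℝ} (h : HasSlope p σ) (h' : HasSlope p τ) : σ = τ :=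
  mul_left_cancel₀ h.1 (h.2.symm.trans h'.2)

/-- The horizontal axis, which is dual to the origin. -/
def horizontalAxis (t : ℝ) : Plane := (t, 0)

lemma horizontalAxis_parametrizes : ParametrizesPseudoline horizontalAxis :=
  Topology.IsClosedEmbedding.of_continuous_injective_isClosedMap
    (by unfold horizontalAxis; fun_prop) (fun _ _ h => congrArg Prod.fst h)
    (isClosedMap_prodMk_right 0)

lemma HasSlope.crossesOnceAt {p : Plane} {τ : ℝ} (h : HasSlope p τ) :
    CrossesOnceAt horizontalAxis p τ := by
  obtain ⟨h0, h1⟩ := h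
  have key : ∀ s, p.1 * s - p.2 = p.1 * (s - τ) := fun s => by rw [h1]; ring
  simp only [CrossesOnceAt, dualLine, aboveDual, belowDual, horizontalAxis, Set.mem_ofPred_eq, key]
  refine ⟨by ring, ?_⟩
  rcases lt_or_gt_of_ne h0 with hp | hp
  · exact Or.inr ⟨fun s hs => mul_pos_of_neg_of_neg hp (sub_neg.2 hs),
      fun s hs => mul_neg_of_neg_of_pos hp (sub_pos.2 hs)⟩
  · exact Or.inl ⟨fun s hs => mul_neg_of_pos_of_neg hp (sub_neg.2 hs),
      fun s hs => mul_pos hp (sub_pos.2 hs)⟩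

lemma redPoint_hasSlope {m j : ℕ} (hm : 0 < m) (hj : j < 11 * m) :
    HasSlope (redPoint m j) (pointSlope m (2 * j)) := by
  refine ⟨?_, mul_comm _ _⟩
  rcases lt_or_ge j (5 * m) with h | h
  · have := bounds_B (redPoint_mem_B hm h); intro e; linarith
  · have := bounds_A (redPoint_mem_A hm h hj); intro e; linarith

lemma leftPoint_hasSlope {m j : ℕ} (hm : 0 < m) (hj : j < 10 * m) :
    HasSlope (leftPoint m j) (pointSlope m (2 * (j + m) + 1)) := by
  refine ⟨?_, mul_comm _ _⟩
  have := bounds_L (leftPoint_mem hm hj); intro e; linarith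

/-- The points 0 and 1 of R lie on either side of the vertical axis, deep below the origin. Their
slopes therefore fall outside [0, 9/8] at opposite ends, which makes them the last and the first
line of the path. -/
lemma rightPoint_one_hasSlope {m : ℕ} (hm : 0 < m) : ∃ τ < 0, HasSlope (rightPoint m 1) τ := by
  have h0 : (0 : ℝ) < (rightPoint m 1).1 := by
    have : (0 : ℝ) < m := by exact_mod_cast hm
    simp only [rightPoint, low]; push_cast; positivity
  have h1 := bounds_R (rightPoint_mem hm (j := 1) (by omega))
  exact ⟨(rightPoint m 1).2 / (rightPoint m 1).1, div_neg_of_neg_of_pos (by linarith) h0, h0.ne',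
    (mul_div_cancel₀ _ h0.ne').symm⟩

lemma rightPoint_zero_hasSlope {m : ℕ} (hm : 0 < m) : ∃ τ > 2, HasSlope (rightPoint m 0) τ := by
  have h0 : (rightPoint m 0).1 < 0 := by
    have : (0 : ℝ) < m := by exact_mod_cast hm
    simp only [rightPoint, low]
    exact div_neg_of_neg_of_pos (by norm_num) (by positivity)
  have h1 := bounds_R (rightPoint_mem hm (j := 0) (by omega))
  refine ⟨(rightPoint m 0).2 / (rightPoint m 0).1, ?_, h0.ne, (mul_div_cancel₀ _ h0.ne).symm⟩
  rw [gt_iff_lt, lt_div_iff_of_neg h0]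
  linarith

/-- The points whose duals are crossed by the horizontal axis, in this order. -/
noncomputable def pathPoint (m i : ℕ) : Plane :=
  if i = 0 then rightPoint m 1 else if i = 20 * m - 1 then rightPoint m 0
  -- The pairs are blue-red except the last, which is red-blue because the path ends in R. Two red
  -- lines meet at the border of the last two pairs, as semialternation permits.
  else if i = 20 * m - 2 then redPoint m (11 * m - 1)
  else if i % 2 = 1 then redPoint m (m + i / 2) else leftPoint m (i / 2 - 1)

lemma exists_pathSlope {m : ℕ} (hm : 0 < m) : ∃ t : Fin (2 * (10 * m)) → ℝ, StrictMono t ∧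
    ∀ i : Fin (2 * (10 * m)), HasSlope (pathPoint m i) (t i) := by
  obtain ⟨a, ha, hra⟩ := rightPoint_one_hasSlope hm
  obtain ⟨b, hb, hrb⟩ := rightPoint_zero_hasSlope hm
  refine ⟨fun i => if (i : ℕ) = 0 then a else if (i : ℕ) = 20 * m - 1 then b
    -- Slope indices are even for red and odd for L; the path starts at 2m, omitting the first m red
    -- lines. Near the end it skips 22m - 3, which belongs to `leftPoint m (10 * m - 2)`, a point
    -- outside `pointsL m`.
    else pointSlope m (if (i : ℕ) = 20 * m - 2 then 22 * m - 2 else 2 * m + i - 1), ?_, ?_⟩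
  · intro i j hij
    have hij' : (i : ℕ) < j := hij
    have hi := i.2
    have hj := j.2
    have hs : ∀ n, n < 22 * m → a < pointSlope m n ∧ pointSlope m n < b := fun n hn => by
      have := pointSlope_mem hm hn
      exact ⟨by linarith [this.1], by linarith [this.2]⟩
    dsimp only
    rw [if_neg (by omega : ¬ (j : ℕ) = 0), if_neg (by omega : ¬ (i : ℕ) = 20 * m - 1)]
    by_cases h1 : (i : ℕ) = 0
    · rw [if_pos h1]
      by_cases h2 : (j : ℕ) = 20 * m - 1
      · rw [if_pos h2]; linarith
      · rw [if_neg h2]; exact (hs _ (by split_ifs <;> omega)).1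
    · rw [if_neg h1]
      by_cases h2 : (j : ℕ) = 20 * m - 1
      · rw [if_pos h2]; exact (hs _ (by split_ifs <;> omega)).2
      · rw [if_neg h2]; exact pointSlope_strictMono hm (by split_ifs <;> omega)
  · intro i
    have hi := i.2
    dsimp only [pathPoint]
    split_ifs with h1 h2 h3 h4
    · exact hra
    · exact hrb
    · convert redPoint_hasSlope hm (j := 11 * m - 1) (by omega) using 2
      omega
    · convert redPoint_hasSlope hm (j := m + i / 2) (by omega) using 2
      omega
    · convert leftPoint_hasSlope hm (j := i / 2 - 1) (by omega) using 2
      omega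

lemma redPoint_injOn {m : ℕ} (hm : 0 < m) : Set.InjOn (redPoint m) (Set.Iio (11 * m)) := by
  intro i hi j hj h
  have h1 := redPoint_hasSlope hm hi
  rw [h] at h1
  have := (pointSlope_strictMono hm).injective (h1.unique (redPoint_hasSlope hm hj))
  omega

lemma leftPoint_injOn {m : ℕ} (hm : 0 < m) : Set.InjOn (leftPoint m) (Set.Iio (10 * m)) := by
  intro i hi j hj h
  have h1 := leftPoint_hasSlope hm hi
  rw [h] at h1
  have := (pointSlope_strictMono hm).injective (h1.unique (leftPoint_hasSlope hm hj))
  omega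

lemma rightPoint_injective {m : ℕ} (hm : 0 < m) : Function.Injective (rightPoint m) := by
  intro i j h
  have hm' : (80 * m : ℝ) ≠ 0 := by positivity
  have h1 : (2 * i - 1 : ℝ) / (80 * m) = (2 * j - 1) / (80 * m) := congrArg Prod.fst h
  rw [div_left_inj' hm'] at h1
  have h2 : (i : ℝ) = j := by linarith
  exact_mod_cast h2

/-- The red points of the construction in the column `A`. -/
noncomputable def pointsA (m : ℕ) : Finset Plane := (Finset.Ico (5 * m) (11 * m)).image (redPoint m)
/-- The red points of the construction in the column `B`. -/
noncomputable def pointsB (m : ℕ) : Finset Plane := (Finset.range (5 * m)).image (redPoint m)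
/-- The blue points of the construction in the column `L`. -/
noncomputable def pointsL (m : ℕ) : Finset Plane := (Finset.range (10 * m - 2)).image (leftPoint m)
/-- The blue points of the construction in the column `R`. -/
noncomputable def pointsR (m : ℕ) : Finset Plane := (Finset.range (m + 2)).image (rightPoint m)

lemma pointsA_subset {m : ℕ} (hm : 0 < m) : (pointsA m : Set Plane) ⊆ columnA := by
  intro p hp
  obtain ⟨j, hj, rfl⟩ := Finset.mem_image.1 (Finset.mem_coe.1 hp)
  rw [Finset.mem_Ico] at hj
  exact redPoint_mem_A hm hj.1 hj.2

lemma pointsB_subset {m : ℕ} (hm : 0 < m) : (pointsB m : Set Plane) ⊆ columnB := by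
  intro p hp
  obtain ⟨j, hj, rfl⟩ := Finset.mem_image.1 (Finset.mem_coe.1 hp)
  exact redPoint_mem_B hm (Finset.mem_range.1 hj)

lemma pointsL_subset {m : ℕ} (hm : 0 < m) : (pointsL m : Set Plane) ⊆ columnL := by
  intro p hp
  obtain ⟨j, hj, rfl⟩ := Finset.mem_image.1 (Finset.mem_coe.1 hp)
  rw [Finset.mem_range] at hj
  exact leftPoint_mem hm (by omega)

lemma pointsR_subset {m : ℕ} (hm : 0 < m) : (pointsR m : Set Plane) ⊆ columnR := by
  intro p hp
  obtain ⟨j, hj, rfl⟩ := Finset.mem_image.1 (Finset.mem_coe.1 hp)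
  exact rightPoint_mem hm (Finset.mem_range.1 hj)

lemma card_pointsA {m : ℕ} (hm : 0 < m) : (pointsA m).card = 6 * m := by
  unfold pointsA
  rw [Finset.card_image_of_injOn ((redPoint_injOn hm).mono fun j hj => (Finset.mem_Ico.1 hj).2),
    Nat.card_Ico]
  omega

lemma card_pointsB {m : ℕ} (hm : 0 < m) : (pointsB m).card = 5 * m := by
  unfold pointsB
  rw [Finset.card_image_of_injOn ((redPoint_injOn hm).mono fun j hj => ?_), Finset.card_range]
  have := Finset.mem_range.1 hj
  exact Set.mem_Iio.2 (by omega)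

lemma card_pointsL {m : ℕ} (hm : 0 < m) : (pointsL m).card = 10 * m - 2 := by
  unfold pointsL
  rw [Finset.card_image_of_injOn ((leftPoint_injOn hm).mono fun j hj => ?_), Finset.card_range]
  have := Finset.mem_range.1 hj
  exact Set.mem_Iio.2 (by omega)

lemma card_pointsR {m : ℕ} (hm : 0 < m) : (pointsR m).card = m + 2 := by
  unfold pointsR
  rw [Finset.card_image_of_injective _ (rightPoint_injective hm), Finset.card_range]

lemma columnConfig_points {m : ℕ} (hm : 0 < m) :
    ColumnConfig (pointsA m) (pointsB m) (pointsL m) (pointsR m) :=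
  columnConfig_of_subset (pointsA_subset hm) (pointsB_subset hm) (pointsL_subset hm)
    (pointsR_subset hm)

lemma redPoint_mem {m j : ℕ} (hj : j < 11 * m) : redPoint m j ∈ pointsA m ∪ pointsB m := by
  rcases lt_or_ge j (5 * m) with h | h
  · exact Finset.mem_union_right _ (Finset.mem_image_of_mem _ (Finset.mem_range.2 h))
  · exact Finset.mem_union_left _ (Finset.mem_image_of_mem _ (Finset.mem_Ico.2 ⟨h, hj⟩))

/-- The horizontal axis is a semialternating pseudoline for `20 m` of the lines. -/
theorem containsSemialternatingPath_points {m : ℕ} (hm : 0 < m) :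
    ContainsSemialternatingPath (pointsL m ∪ pointsR m) (pointsA m ∪ pointsB m) (20 * m) := by
  obtain ⟨t, ht, hslope⟩ := exists_pathSlope hm
  set S : Finset Plane := pointsL m ∪ {rightPoint m 0, rightPoint m 1} with hS
  set T : Finset Plane := (Finset.Ico m (11 * m)).image (redPoint m) with hT
  have hR : ({rightPoint m 0, rightPoint m 1} : Finset Plane) ⊆ pointsR m := by
    intro p hp
    rw [Finset.mem_insert, Finset.mem_singleton] at hp
    rcases hp with rfl | rfl <;> exact Finset.mem_image_of_mem _ (Finset.mem_range.2 (by omega))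
  have hSsub : S ⊆ pointsL m ∪ pointsR m := Finset.union_subset_union_right hR
  have hTsub : T ⊆ pointsA m ∪ pointsB m := by
    intro p hp
    obtain ⟨j, hj, rfl⟩ := Finset.mem_image.1 hp
    exact redPoint_mem (Finset.mem_Ico.1 hj).2
  have hScard : S.card = 10 * m := by
    rw [hS, Finset.card_union_of_disjoint
      ((columnConfig_points hm).disjoint_blue.mono_right hR), card_pointsL hm,
      Finset.card_pair ((rightPoint_injective hm).ne zero_ne_one)]
    omega
  have hTcard : T.card = 10 * m := by
    rw [hT, Finset.card_image_of_injOn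
      ((redPoint_injOn hm).mono fun j hj => (Finset.mem_Ico.1 hj).2), Nat.card_Ico]
    omega
  have hr0 : rightPoint m 0 ∈ S := by simp [hS]
  have hr1 : rightPoint m 1 ∈ S := by simp [hS]
  have hleft : ∀ j, j < 10 * m - 2 → leftPoint m j ∈ S := fun j hj =>
    Finset.mem_union_left _ (Finset.mem_image_of_mem _ (Finset.mem_range.2 hj))
  have hredp : ∀ j, m ≤ j → j < 11 * m → redPoint m j ∈ T := fun j h1 h2 =>
    Finset.mem_image_of_mem _ (Finset.mem_Ico.2 ⟨h1, h2⟩)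
  have hblue : ∀ i, i = 0 ∨ i = 20 * m - 1 ∨ (i % 2 = 0 ∧ i < 20 * m - 2) →
      pathPoint m i ∈ S := by
    intro i hi
    unfold pathPoint
    split_ifs with h1 h2 h3 h4
    · exact hr1
    · exact hr0
    · omega
    · omega
    · exact hleft _ (by omega)
  have hred : ∀ i, i = 20 * m - 2 ∨ (i % 2 = 1 ∧ i < 20 * m - 2) → pathPoint m i ∈ T := by
    intro i hi
    unfold pathPoint
    split_ifs with h1 h2 h3 h4
    · omega
    · omega
    · exact hredp _ (by omega) (by omega)
    · exact hredp _ (by omega) (by omega)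
    · omega
  have hinj : Function.Injective fun i : Fin (2 * (10 * m)) => pathPoint m i := by
    intro i j h
    have h1 := hslope i
    rw [show pathPoint m i = pathPoint m j from h] at h1
    exact ht.injective (h1.unique (hslope j))
  refine ⟨S, hSsub, T, hTsub, by omega, horizontalAxis, horizontalAxis_parametrizes, 10 * m,
    fun i => pathPoint m i, t, hScard, hTcard, hinj, ?_, ht, fun i => (hslope i).crossesOnceAt, ?_⟩
  · have hsub : Finset.univ.image (fun i : Fin (2 * (10 * m)) => pathPoint m i) ⊆ S ∪ T := by
      intro p hp
      obtain ⟨i, -, rfl⟩ := Finset.mem_image.1 hp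
      have hi := i.2
      by_cases h : (i : ℕ) = 0 ∨ (i : ℕ) = 20 * m - 1 ∨ ((i : ℕ) % 2 = 0 ∧ (i : ℕ) < 20 * m - 2)
      · exact Finset.mem_union_left _ (hblue i h)
      · exact Finset.mem_union_right _ (hred i (by omega))
    have heq := Finset.eq_of_subset_of_card_le hsub (by
      rw [Finset.card_image_of_injective _ hinj, Finset.card_univ, Fintype.card_fin]
      exact (Finset.card_union_le _ _).trans (by omega))
    rw [← Finset.coe_union, ← heq, Finset.coe_image, Finset.coe_univ, Set.image_univ]
  · intro i j hi hj
    have hi2 := Nat.even_iff.1 hi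
    have hj2 := j.2
    by_cases h : (i : ℕ) = 20 * m - 2
    · exact Or.inr ⟨hred i (Or.inl h), hblue j (by omega)⟩
    · exact Or.inl ⟨hblue i (by omega), hred j (by omega)⟩

theorem mainTheorem11 (n : ℕ) (hn : 0 < n) (h11 : 11 ∣ n) :
    ∃ B R : Finset Plane, B.card = n ∧ R.card = n ∧
      GeneralPosition ((B : Set Plane) ∪ (R : Set Plane)) ∧
      IsOneAvoiding (B : Set Plane) (R : Set Plane) ∧
      ∃ s : ℕ, IsGreatest {s | ContainsSemialternatingPath B R s} s ∧
        (s : ℝ) = 10 / 11 * (2 * (n : ℝ)) := by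
  obtain ⟨m, rfl⟩ := h11
  have hm : 0 < m := by omega
  have hc := columnConfig_points hm
  have cA := card_pointsA hm
  have cB := card_pointsB hm
  have cL := card_pointsL hm
  have cR := card_pointsR hm
  have hblue : ((pointsL m ∪ pointsR m : Finset Plane) : Set Plane) ⊆ columnL ∪ columnR := by
    rw [Finset.coe_union]
    exact Set.union_subset_union (pointsL_subset hm) (pointsR_subset hm)
  have hred : ((pointsA m ∪ pointsB m : Finset Plane) : Set Plane) ⊆ columnA ∪ columnB := by
    rw [Finset.coe_union]
    exact Set.union_subset_union (pointsA_subset hm) (pointsB_subset hm)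
  refine ⟨pointsL m ∪ pointsR m, pointsA m ∪ pointsB m, ?_, ?_, generalPosition_of_subset ?_,
    isOneAvoiding_of_subset hblue hred, 20 * m, ⟨containsSemialternatingPath_points hm, ?_⟩, ?_⟩
  · rw [Finset.card_union_of_disjoint hc.disjoint_blue]; omega
  · rw [Finset.card_union_of_disjoint hc.disjoint_red]; omega
  · rw [Set.union_comm (columnA ∪ columnB)]
    exact Set.union_subset_union hblue hred
  · intro s hs
    -- The bound for L is an equality. The one for A reads 7m + 3 ≤ 10m, with equality at m = 1.
    have := hc.path_card_le (K := 10 * m) (by omega) (by omega) (by omega) hs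
    omega
  · push_cast; ring
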